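/- Let $\mathbf{Top}$ be the category of topological spaces, $\mathbf{Top}^{\mathbf 2}$ its category of arrows, and $\mathcal J$ the set of inclusions $\partial j=S^{n-1}\to \bar\jmath=D^n$, $n\ge 0$ (with $S^{-1}=\emptyset$). *Cell complexes.* A stratum $(X,S)$ is a space $X$ with a set $S$ of cells and, for each $s\in S$, some $\kappa_s\in\mathcal J$ and a continuous map $b_s\colon\partial\kappa_s\to X$; its body $\overline{(X,S)}$ is the pushout of $\coprod_s\partial\kappa_s\to\coprod_s\bar\kappa_s$ along $\langle b_s\rangle\colon\coprod_s\partial\kappa_s\to X$. A morphism $(f,p)\colon(X,S)\to(Y,T)$ is a continuous $f\colon X\to Y$ and a function $p\colon S\to T$ with $\kappa_{p(s)}=\kappa_s$ and $f b_s=b_{p(s)}$; it induces a map of bodies. A relative cell complex is a sequence of strata $(X_n,S_n)_{n\in\mathbb N}$ with $X_{n+1}=\overline{(X_n,S_n)}$ such that for no $s\in S_n$ does $b_s$ factor through $X_m$ with $m<n$. Its body is $\operatorname{colim}_n X_n$ and its boundary is $X_0$. A morphism is a sequence of morphisms of strata $(f_n,p_n)$ with $f_{n+1}=\overline{(f_n,p_n)}$.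 This gives a category $\mathbf{CellCx}$ with a functor $U\colon\mathbf{CellCx}\to\mathbf{Top}^{\mathbf 2}$ sending a complex $A$ to the map $\partial A\to\bar A$ from its boundary to its body. *Free cell complexes.* For $f\colon A\to B$ put $A_0=A$, $E_0f=f$; let $S_n$ be the set of commutative squares from some $j\in\mathcal J$ to $E_nf\colon A_n\to B$ whose boundary map $\partial j\to A_n$ does not factor through $A_{n-1}$ (no condition if $n=0$), let $A_{n+1}=\overline{(A_n,S_n)}$, and let $E_{n+1}f\colon A_{n+1}\to B$ be induced by $E_nf$ and the squares. This defines a cell complex $Kf$ with boundary $A$ and a map $Ef\colon\overline{Kf}\to B$ with $Ef\circ UKf=f$. *Composition.* Let $A=(X_n,S_n)$ be a cell complex and $(Y,T)$ a stratum with $Y=\bar A$. Their composite has boundary $X_0$ and as cells in level $n$ those of $S_n$ together with those $t\in T$ for which $n$ is the smallest number such that $b_t$ factors through $X_n$. If $B$ is a cell complex with $\partial B=\bar A$, then $B*A$ is the colimit of the sequence obtained from $A$ by composing the strata of $B$ onto it one after the other. **Proposition.** 1. $K$ extends to a functor right adjoint to $U$, with counit $(1,Ef)\colon UKf\to f$.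 Hence $UK$ is a comonad on $\mathbf{Top}^{\mathbf 2}$, with counit $(1,Ef)$, and $f\mapsto(UKf,Ef)$ is a functorial factorisation; in particular $E$ is an endofunctor of $\mathbf{Top}^{\mathbf 2}$, pointed by $\vec\eta_f=(UKf,1)$. 2. Whenever $\partial B=\bar A$, the composite $B*A$ exists as a cell complex, and its underlying map is the composite of the underlying maps of $A$ and $B$. 3. Let $\mu_f\colon\overline{KEf}\to\overline{Kf}$ be the body part of the cell complex morphism $KEf*Kf\to Kf$ that corresponds under the adjunction to $(1,EEf)\colon U(KEf*Kf)\to f$. Then $\vec\mu_f=(\mu_f,1)$ is natural and makes $(E,\vec\eta,\vec\mu)$ a monad on $\mathbf{Top}^{\mathbf 2}$. 4. $(UK,E)$ is an algebraic weak factorisation system on $\mathbf{Top}$: writing $\vec\delta_f=(1,\delta_f)$ for the comultiplication of $UK$, the squares $(\delta_f,\mu_f)\colon UKEf\to EUKf$ form a natural transformation $\Delta\colon UK\,E\Rightarrow E\,UK$ that is a distributive law of the comonad $UK$ over the monad $E$, i.e. it is compatible with the unit and multiplication of $E$ and with the counit and comultiplication of $UK$. -/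

import Mathlib

open CategoryTheory CategoryTheory.Limits TopCat

universe u v w

noncomputable section

/-! ### Strata -/

/-- A stratum `(X, S)`: a space `X`, a set `S` of cells and, for every cell `s`, a generating
map `κ s` (the inclusion `∂𝔻 n ⟶ 𝔻 n` with `n = κ s`; it is `∅ ⟶ pt` for `n = 0`) with a
continuous attaching map `b s` from its boundary to `X`. -/
structure Stratum where
  X : TopCat.{u}
  S : Type u
  κ : S → ℕ
  b : ∀ s : S, diskBoundary.{u} (κ s) ⟶ X

namespace Stratum

/-- The body of a stratum: all cells are glued onto `X` along their attaching maps. -/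
def body (P : Stratum.{u}) : TopCat.{u} :=
  pushout (Sigma.desc P.b) (Limits.Sigma.map fun s : P.S => diskBoundaryInclusion.{u} (P.κ s))

/-- The map from the boundary of a stratum to its body. -/
def incl (P : Stratum.{u}) : P.X ⟶ P.body := pushout.inl _ _

/-- The characteristic map of a cell. -/
def cell (P : Stratum.{u}) (s : P.S) : disk.{u} (P.κ s) ⟶ P.body :=
  Sigma.ι (fun s : P.S => disk.{u} (P.κ s)) s ≫ pushout.inr _ _

theorem condition (P : Stratum.{u}) (s : P.S) :
    P.b s ≫ P.incl = diskBoundaryInclusion (P.κ s) ≫ P.cell s := by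
  have h := Sigma.ι (fun s : P.S => diskBoundary.{u} (P.κ s)) s ≫=
    (pushout.condition (f := Sigma.desc P.b)
      (g := Limits.Sigma.map fun s : P.S => diskBoundaryInclusion.{u} (P.κ s)))
  simp only [ι_colimMap_assoc, Discrete.natTrans_app, colimit.ι_desc_assoc, Cofan.mk_ι_app,
    Limits.Sigma.map] at h
  exact h

/-- A map out of the body is given by a map out of the boundary and compatible maps out of
the cells. -/
def desc (P : Stratum.{u}) {W : TopCat.{u}} (g : P.X ⟶ W) (c : ∀ s, disk.{u} (P.κ s) ⟶ W)
    (h : ∀ s, P.b s ≫ g = diskBoundaryInclusion (P.κ s) ≫ c s) : P.body ⟶ W :=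
  pushout.desc g (Sigma.desc c) (by ext1 s; simpa using h s)

@[simp]
theorem incl_desc (P : Stratum.{u}) {W : TopCat.{u}} (g : P.X ⟶ W)
    (c : ∀ s, disk.{u} (P.κ s) ⟶ W)
    (h : ∀ s, P.b s ≫ g = diskBoundaryInclusion (P.κ s) ≫ c s) :
    P.incl ≫ P.desc g c h = g :=
  pushout.inl_desc _ _ _

@[simp]
theorem cell_desc (P : Stratum.{u}) {W : TopCat.{u}} (g : P.X ⟶ W)
    (c : ∀ s, disk.{u} (P.κ s) ⟶ W)
    (h : ∀ s, P.b s ≫ g = diskBoundaryInclusion (P.κ s) ≫ c s) (s : P.S) :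
    P.cell s ≫ P.desc g c h = c s :=
  (Category.assoc _ _ _).trans
    ((congrArg _ (pushout.inr_desc _ _ _)).trans (Limits.Sigma.ι_desc _ _))

theorem body_hom_ext (P : Stratum.{u}) {W : TopCat.{u}} {g h : P.body ⟶ W}
    (h₁ : P.incl ≫ g = P.incl ≫ h) (h₂ : ∀ s, P.cell s ≫ g = P.cell s ≫ h) : g = h := by
  apply pushout.hom_ext h₁
  ext1 s
  exact (Category.assoc _ _ _).symm.trans ((h₂ s).trans (Category.assoc _ _ _))

/-- A morphism of strata: a continuous map `f` and a map `p` of cells, preserving the shape of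
every cell and its attaching map. -/
@[ext]
structure Hom (P Q : Stratum.{u}) where
  f : P.X ⟶ Q.X
  p : P.S → Q.S
  hκ : ∀ s, P.κ s = Q.κ (p s)
  hb : ∀ s, P.b s ≫ f = eqToHom (congrArg diskBoundary.{u} (hκ s)) ≫ Q.b (p s)

instance : Category Stratum.{u} where
  Hom := Hom
  id P := { f := 𝟙 _, p := id, hκ := fun _ => rfl, hb := fun _ => by simp }
  comp φ ψ :=
    { f := φ.f ≫ ψ.f
      p := ψ.p ∘ φ.p
      hκ := fun s => (φ.hκ s).trans (ψ.hκ _)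
      hb := fun s => by
        rw [← Category.assoc, φ.hb, Category.assoc, ψ.hb, ← Category.assoc, eqToHom_trans]
        rfl }

@[simp] theorem id_f (P : Stratum.{u}) : Hom.f (𝟙 P) = 𝟙 P.X := rfl
@[simp] theorem id_p (P : Stratum.{u}) (s : P.S) : Hom.p (𝟙 P) s = s := rfl
@[simp] theorem comp_f {P Q R : Stratum.{u}} (φ : P ⟶ Q) (ψ : Q ⟶ R) :
    Hom.f (φ ≫ ψ) = φ.f ≫ ψ.f := rfl
@[simp] theorem comp_p {P Q R : Stratum.{u}} (φ : P ⟶ Q) (ψ : Q ⟶ R) (s : P.S) :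
    Hom.p (φ ≫ ψ) s = ψ.p (φ.p s) := rfl

@[ext]
theorem hom_ext {P Q : Stratum.{u}} {φ ψ : P ⟶ Q} (h₁ : φ.f = ψ.f) (h₂ : φ.p = ψ.p) : φ = ψ :=
  Hom.ext h₁ h₂

theorem boundary_eqToHom {m n : ℕ} (h : m = n) :
    diskBoundaryInclusion.{u} m ≫ eqToHom (congrArg disk.{u} h) =
      eqToHom (congrArg diskBoundary.{u} h) ≫ diskBoundaryInclusion.{u} n := by
  subst h; simp

/-- The map between the bodies induced by a morphism of strata: it is `f` on the boundary and
maps the cell `s` identically to the cell `p s`. -/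
def bodyMap {P Q : Stratum.{u}} (φ : P ⟶ Q) : P.body ⟶ Q.body :=
  P.desc (φ.f ≫ Q.incl) (fun s => eqToHom (congrArg disk.{u} (φ.hκ s)) ≫ Q.cell (φ.p s))
    (fun s => by
      rw [← Category.assoc, φ.hb, Category.assoc, condition, ← Category.assoc, ← Category.assoc,
        boundary_eqToHom (φ.hκ s)])

@[simp]
theorem incl_bodyMap {P Q : Stratum.{u}} (φ : P ⟶ Q) :
    P.incl ≫ bodyMap φ = φ.f ≫ Q.incl := by simp [bodyMap]

@[simp]
theorem cell_bodyMap {P Q : Stratum.{u}} (φ : P ⟶ Q) (s : P.S) :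
    P.cell s ≫ bodyMap φ = eqToHom (congrArg disk.{u} (φ.hκ s)) ≫ Q.cell (φ.p s) := by
  simp [bodyMap]

theorem bodyMap_id (P : Stratum.{u}) : bodyMap (𝟙 P) = 𝟙 _ := by
  apply body_hom_ext
  · simp
  · intro s; simp

theorem bodyMap_comp {P Q R : Stratum.{u}} (φ : P ⟶ Q) (ψ : Q ⟶ R) :
    bodyMap (φ ≫ ψ) = bodyMap φ ≫ bodyMap ψ := by
  apply body_hom_ext
  · rw [← Category.assoc, incl_bodyMap, incl_bodyMap, Category.assoc, incl_bodyMap]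
    simp
  · intro s
    rw [← Category.assoc, cell_bodyMap, cell_bodyMap, Category.assoc, cell_bodyMap]
    simp

end Stratum

/-! ### Cell complexes -/

/-- A connected sequence of strata: the boundary of each stratum is the body of the previous
one. -/
structure StrataSeq where
  st : ℕ → Stratum.{u}
  connected : ∀ n, (st n).body = (st (n + 1)).X

namespace StrataSeq

/-- The space `X n`, the boundary of the `n`-th stratum. -/
abbrev X (A : StrataSeq.{u}) (n : ℕ) : TopCat.{u} := (A.st n).X

/-- The identification of the body of a stratum with the boundary of the next one. -/
def glue (A : StrataSeq.{u}) (n : ℕ) : (A.st n).body ≅ A.X (n + 1) := eqToIso (A.connected n)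

/-- The map `X n ⟶ X (n + 1)` underlying the `n`-th stratum. -/
def step (A : StrataSeq.{u}) (n : ℕ) : A.X n ⟶ A.X (n + 1) := (A.st n).incl ≫ (A.glue n).hom

/-- The diagram `X 0 ⟶ X 1 ⟶ X 2 ⟶ ⋯`. -/
def diagram (A : StrataSeq.{u}) : ℕ ⥤ TopCat.{u} := Functor.ofSequence (X := A.X) A.step

/-- The map `X m ⟶ X n` for `m ≤ n`. -/
def trans (A : StrataSeq.{u}) {m n : ℕ} (h : m ≤ n) : A.X m ⟶ A.X n := A.diagram.map (homOfLE h)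

theorem trans_succ (A : StrataSeq.{u}) {m n : ℕ} (h : m ≤ n) :
    A.trans (h.trans n.le_succ) = A.trans h ≫ A.step n := by
  have : A.step n = A.diagram.map (homOfLE n.le_succ) :=
    (Functor.ofSequence_map_homOfLE_succ (X := A.X) A.step n).symm
  rw [this]
  exact A.diagram.map_comp (homOfLE h) (homOfLE n.le_succ)

/-- A sequence is proper if no attaching map in the `n`-th stratum factors through the boundary
of a lower stratum. -/
def IsProper (A : StrataSeq.{u}) : Prop :=
  ∀ (n : ℕ) (s : (A.st n).S) (m : ℕ) (h : m < n),
    ¬ ∃ g : diskBoundary.{u} ((A.st n).κ s) ⟶ A.X m, g ≫ A.trans h.le = (A.st n).b s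

/-- The body of a sequence of strata, the colimit of `X 0 ⟶ X 1 ⟶ X 2 ⟶ ⋯`. -/
def body (A : StrataSeq.{u}) : TopCat.{u} := colimit A.diagram

/-- The canonical map from `X n` to the body. -/
def toBody (A : StrataSeq.{u}) (n : ℕ) : A.X n ⟶ A.body := colimit.ι A.diagram n

@[simp]
theorem step_toBody (A : StrataSeq.{u}) (n : ℕ) : A.step n ≫ A.toBody (n + 1) = A.toBody n := by
  have h := colimit.w A.diagram (homOfLE (Nat.le_add_right n 1))
  rwa [diagram, Functor.ofSequence_map_homOfLE_succ] at h

/-- The natural transformation out of the diagram of `A` given by maps commuting with the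
steps. -/
def natTrans (A : StrataSeq.{u}) (G : ℕ ⥤ TopCat.{u}) (c : ∀ n, A.X n ⟶ G.obj n)
    (h : ∀ n, A.step n ≫ c (n + 1) = c n ≫ G.map (homOfLE (n.le_add_right 1))) :
    A.diagram ⟶ G :=
  NatTrans.ofSequence c (fun n =>
    (congrArg (fun g : A.X n ⟶ A.X (n + 1) => g ≫ c (n + 1))
      (Functor.ofSequence_map_homOfLE_succ (X := A.X) A.step n)).trans (h n))

/-- The map out of the body given by compatible maps out of all `X n`. -/
def bodyDesc (A : StrataSeq.{u}) {W : TopCat.{u}} (c : ∀ n, A.X n ⟶ W)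
    (h : ∀ n, A.step n ≫ c (n + 1) = c n) : A.body ⟶ W :=
  colimit.desc A.diagram ⟨W, A.natTrans ((Functor.const ℕ).obj W) c (fun n => by
    rw [h n]; exact (Category.comp_id _).symm)⟩

@[simp]
theorem toBody_bodyDesc (A : StrataSeq.{u}) {W : TopCat.{u}} (c : ∀ n, A.X n ⟶ W)
    (h : ∀ n, A.step n ≫ c (n + 1) = c n) (n : ℕ) : A.toBody n ≫ A.bodyDesc c h = c n :=
  colimit.ι_desc _ _

theorem body_hom_ext (A : StrataSeq.{u}) {W : TopCat.{u}} {g h : A.body ⟶ W}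
    (H : ∀ n, A.toBody n ≫ g = A.toBody n ≫ h) : g = h :=
  colimit.hom_ext H

/-- A morphism: a coherent sequence of morphisms of strata. -/
@[ext]
structure Hom (A B : StrataSeq.{u}) where
  φ : ∀ n, A.st n ⟶ B.st n
  coherent : ∀ n, (A.glue n).hom ≫ (φ (n + 1)).f = Stratum.bodyMap (φ n) ≫ (B.glue n).hom

instance : Category StrataSeq.{u} where
  Hom := Hom
  id A := { φ := fun n => 𝟙 _, coherent := fun n => by simp [Stratum.bodyMap_id] }
  comp f g :=
    { φ := fun n => f.φ n ≫ g.φ n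
      coherent := fun n => by
        rw [Stratum.comp_f, ← Category.assoc, f.coherent, Category.assoc, g.coherent,
          Stratum.bodyMap_comp, Category.assoc] }

@[simp] theorem id_φ (A : StrataSeq.{u}) (n : ℕ) : Hom.φ (𝟙 A) n = 𝟙 _ := rfl
@[simp] theorem comp_φ {A B C : StrataSeq.{u}} (f : A ⟶ B) (g : B ⟶ C) (n : ℕ) :
    Hom.φ (f ≫ g) n = f.φ n ≫ g.φ n := rfl

@[ext]
theorem hom_ext {A B : StrataSeq.{u}} {f g : A ⟶ B} (h : ∀ n, f.φ n = g.φ n) : f = g :=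
  Hom.ext (funext h)

theorem step_naturality {A B : StrataSeq.{u}} (f : A ⟶ B) (n : ℕ) :
    A.step n ≫ (f.φ (n + 1)).f = (f.φ n).f ≫ B.step n := by
  rw [step, Category.assoc, f.coherent, ← Category.assoc, Stratum.incl_bodyMap, step,
    Category.assoc]

/-- The map between the bodies induced by a morphism. -/
def bodyMap {A B : StrataSeq.{u}} (f : A ⟶ B) : A.body ⟶ B.body :=
  A.bodyDesc (fun n => (f.φ n).f ≫ B.toBody n) (fun n => by
    rw [← Category.assoc, step_naturality, Category.assoc, step_toBody])

@[simp]
theorem toBody_bodyMap {A B : StrataSeq.{u}} (f : A ⟶ B) (n : ℕ) :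
    A.toBody n ≫ bodyMap f = (f.φ n).f ≫ B.toBody n := by simp [bodyMap]

theorem bodyMap_id (A : StrataSeq.{u}) : bodyMap (𝟙 A) = 𝟙 _ := by
  apply body_hom_ext; intro n; simp

theorem bodyMap_comp {A B C : StrataSeq.{u}} (f : A ⟶ B) (g : B ⟶ C) :
    bodyMap (f ≫ g) = bodyMap f ≫ bodyMap g := by
  apply body_hom_ext; intro n
  rw [toBody_bodyMap, ← Category.assoc, toBody_bodyMap, Category.assoc, toBody_bodyMap]
  simp

/-- The underlying map `X 0 ⟶ body`, the transfinite composite of all strata, as a functor to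
the arrow category. -/
def underlying : StrataSeq.{u} ⥤ Arrow TopCat.{u} where
  obj A := Arrow.mk (A.toBody 0)
  map {A B} f := Arrow.homMk (u := (f.φ 0).f) (v := bodyMap f) (by simp)
  map_id A := by
    ext1
    · rfl
    · exact bodyMap_id A
  map_comp f g := by
    ext1
    · rfl
    · exact bodyMap_comp f g

end StrataSeq

/-- The category of relative cell complexes, i.e. of proper connected sequences of strata. -/
abbrev CellCx : Type (u + 1) :=
  ObjectProperty.FullSubcategory (C := StrataSeq.{u}) StrataSeq.IsProper

/-- The forgetful functor from cell complexes to the arrow category of `Top`. -/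
def CellCx.U : CellCx.{u} ⥤ Arrow TopCat.{u} :=
  ObjectProperty.ι (C := StrataSeq.{u}) StrataSeq.IsProper ⋙ StrataSeq.underlying

/-! ### The free cell complex on a map -/

/-- A stage of the construction of the free cell complex over `B`: the space built so far, its
map to `B`, and the predicate saying which attaching maps would be improper. -/
structure FreeStage (B : TopCat.{u}) where
  X : TopCat.{u}
  e : X ⟶ B
  improper : ∀ n : ℕ, (diskBoundary.{u} n ⟶ X) → Prop

namespace FreeStage

variable {B : TopCat.{u}}

/-- The stratum with one cell for each commutative square from a generating map to `e` whose
boundary map is not improper. -/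
def stratum (F : FreeStage.{u} B) : Stratum.{u} where
  X := F.X
  S := { s : Σ n : ℕ, (Arrow.mk (diskBoundaryInclusion.{u} n) ⟶ Arrow.mk F.e) //
    ¬ F.improper s.1 s.2.left }
  κ s := s.1.1
  b s := s.1.2.left

/-- The next stage: the space is the body of the stratum, its map to `B` is induced by the
squares, and an attaching map is improper if it factors through the present space. -/
def next (F : FreeStage.{u} B) : FreeStage.{u} B where
  X := F.stratum.body
  e := F.stratum.desc F.e (fun s => s.1.2.right) (fun s => Arrow.w s.1.2)
  improper n g := ∃ g' : diskBoundary.{u} n ⟶ F.X, g' ≫ F.stratum.incl = g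

end FreeStage

/-- The stages for `f : A ⟶ B`, starting with `f` itself and no improper attaching map. -/
def freeStage (f : Arrow TopCat.{u}) : ℕ → FreeStage.{u} f.right
  | 0 => { X := f.left, e := f.hom, improper := fun _ _ => False }
  | n + 1 => (freeStage f n).next

/-- The sequence of strata of the free cell complex on `f`. -/
def freeSeq (f : Arrow TopCat.{u}) : StrataSeq.{u} where
  st n := (freeStage f n).stratum
  connected _ := rfl

theorem freeSeq_step (f : Arrow TopCat.{u}) (n : ℕ) :
    (freeSeq f).step n = (freeStage f n).stratum.incl := Category.comp_id _

theorem freeSeq_isProper (f : Arrow TopCat.{u}) : (freeSeq f).IsProper := by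
  rintro (_ | n) s m h ⟨g, hg⟩
  · exact absurd h (Nat.not_lt_zero m)
  · refine s.2 ⟨g ≫ (freeSeq f).trans (Nat.lt_succ_iff.1 h), ?_⟩
    rw [StrataSeq.trans_succ (freeSeq f) (Nat.lt_succ_iff.1 h), freeSeq_step] at hg
    exact (Category.assoc _ _ _).trans hg

/-- The free cell complex `K f` on a map `f`. -/
def freeCx (f : Arrow TopCat.{u}) : CellCx.{u} := ⟨freeSeq f, freeSeq_isProper f⟩

/-- The map `E f` from the body of `K f` to the codomain of `f`, induced by the maps of the
stages. -/
def freeE (f : Arrow TopCat.{u}) : (freeSeq f).body ⟶ f.right :=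
  (freeSeq f).bodyDesc (fun n => (freeStage f n).e) (fun n => by
    rw [freeSeq_step]
    exact (freeStage f n).stratum.incl_desc _ _ (fun s => Arrow.w s.1.2))

theorem toBody_freeE (f : Arrow TopCat.{u}) : (freeSeq f).toBody 0 ≫ freeE f = f.hom :=
  (freeSeq f).toBody_bodyDesc (fun n => (freeStage f n).e) _ 0

/-- The canonical morphism `(1, E f)` from the underlying map of `K f` to `f`. -/
def freeCounit (f : Arrow TopCat.{u}) : CellCx.U.obj (freeCx f) ⟶ f :=
  Arrow.homMk (u := 𝟙 f.left) (v := freeE f)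
    ((Category.id_comp _).trans (toBody_freeE f).symm)

/-- The universal property of the free cell complexes. -/
def FreeProperty : Prop :=
  ∀ (C : CellCx.{u}) (f : Arrow TopCat.{u}) (α : CellCx.U.obj C ⟶ f),
    ∃! φ : C ⟶ freeCx f, CellCx.U.map φ ≫ freeCounit f = α

namespace FreeProperty

/-- The bijection between maps `U C ⟶ f` and morphisms `C ⟶ K f`. -/
def equiv (h : FreeProperty.{u}) (C : CellCx.{u}) (f : Arrow TopCat.{u}) :
    (CellCx.U.obj C ⟶ f) ≃ (C ⟶ freeCx f) where
  toFun α := (h C f α).choose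
  invFun φ := CellCx.U.map φ ≫ freeCounit f
  left_inv α := (h C f α).choose_spec.1
  right_inv φ := ((h C f (CellCx.U.map φ ≫ freeCounit f)).choose_spec.2 φ rfl).symm

theorem equiv_naturality (h : FreeProperty.{u}) (C' C : CellCx.{u}) (f : Arrow TopCat.{u})
    (φ : C' ⟶ C) (α : CellCx.U.obj C ⟶ f) :
    h.equiv C' f (CellCx.U.map φ ≫ α) = φ ≫ h.equiv C f α := by
  rw [← Equiv.eq_symm_apply]
  change _ = CellCx.U.map (φ ≫ h.equiv C f α) ≫ freeCounit f
  rw [Functor.map_comp, Category.assoc]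
  congr 1
  exact ((h.equiv C f).symm_apply_apply α).symm

/-- The functor `K`, given on objects by the free cell complexes. -/
def K (h : FreeProperty.{u}) : Arrow TopCat.{u} ⥤ CellCx.{u} :=
  Adjunction.rightAdjointOfEquiv h.equiv h.equiv_naturality

/-- The adjunction between `U` and `K`, with counit `(1, E f)`. -/
def adj (h : FreeProperty.{u}) : CellCx.U.{u} ⊣ h.K :=
  Adjunction.adjunctionOfEquivRight h.equiv h.equiv_naturality

/-- The comonad `UK` of the adjunction. -/
def comonad (h : FreeProperty.{u}) : Comonad (Arrow TopCat.{u}) := h.adj.toComonad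

theorem U_map_K_map (h : FreeProperty.{u}) {f g : Arrow TopCat.{u}} (α : f ⟶ g) :
    CellCx.U.map (h.K.map α) ≫ freeCounit g = freeCounit f ≫ α := by
  refine ((h.equiv _ _).symm_apply_apply _).trans ?_
  change (CellCx.U.map (𝟙 _) ≫ freeCounit f) ≫ α = _
  rw [CategoryTheory.Functor.map_id, Category.id_comp]

end FreeProperty

/-! ### Algebraic weak factorisation systems -/

/-- A functorial factorisation `f ↦ (dom f ⟶ M f ⟶ cod f)`; the central functor `M` is `Z`, the
two factors are `i` and `p`. -/
abbrev FunctorialFactorisation (C : Type v) [Category.{w} C] :=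
  MorphismProperty.FunctorialFactorizationData (⊤ : MorphismProperty C) (⊤ : MorphismProperty C)

namespace FunctorialFactorisation

variable {C : Type v} [Category.{w} C] (F : FunctorialFactorisation C)

/-- The left endofunctor of the arrow category. -/
def L : Arrow C ⥤ Arrow C where
  obj f := Arrow.mk (F.i.app f)
  map {f g} α := Arrow.homMk (u := α.left) (v := F.Z.map α) (F.i.naturality α)

/-- The right endofunctor of the arrow category. -/
def R : Arrow C ⥤ Arrow C where
  obj f := Arrow.mk (F.p.app f)
  map {f g} α := Arrow.homMk (u := F.Z.map α) (v := α.right) (F.p.naturality α)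

/-- The counit `(1, R f)` of the left functor. -/
def ε : F.L ⟶ 𝟭 (Arrow C) where
  app f := Arrow.homMk (u := 𝟙 f.left) (v := F.p.app f)
    ((Category.id_comp _).trans F.fac_app.symm)
  naturality f g α := by
    ext1
    · exact (Category.comp_id _).trans (Category.id_comp _).symm
    · exact F.p.naturality α

/-- The unit `(L f, 1)` of the right functor. -/
def η : 𝟭 (Arrow C) ⟶ F.R where
  app f := Arrow.homMk (u := F.i.app f) (v := 𝟙 f.right)
    (F.fac_app.trans (Category.comp_id _).symm)
  naturality f g α := by
    ext1
    · exact F.i.naturality α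
    · exact (Category.comp_id _).trans (Category.id_comp _).symm

end FunctorialFactorisation

/-- An algebraic weak factorisation system with underlying functorial factorisation `F`: the
copointed functor `(L, ε)` is extended to a comonad, the pointed functor `(R, η)` is extended to
a monad, and the maps `(δ_f, μ_f) : L R f ⟶ R L f` form a distributive law of the comonad over
the monad. -/
structure AlgebraicWFS {C : Type v} [Category.{w} C] (F : FunctorialFactorisation C) where
  δ : F.L ⟶ F.L ⋙ F.L
  coassoc : ∀ f, δ.app f ≫ F.L.map (δ.app f) = δ.app f ≫ δ.app (F.L.obj f)
  left_counit : ∀ f, δ.app f ≫ F.ε.app (F.L.obj f) = 𝟙 (F.L.obj f)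
  right_counit : ∀ f, δ.app f ≫ F.L.map (F.ε.app f) = 𝟙 (F.L.obj f)
  μ : F.R ⋙ F.R ⟶ F.R
  assoc : ∀ f, F.R.map (μ.app f) ≫ μ.app f = μ.app (F.R.obj f) ≫ μ.app f
  left_unit : ∀ f, F.η.app (F.R.obj f) ≫ μ.app f = 𝟙 (F.R.obj f)
  right_unit : ∀ f, F.R.map (F.η.app f) ≫ μ.app f = 𝟙 (F.R.obj f)
  Δ : F.R ⋙ F.L ⟶ F.L ⋙ F.R
  Δ_left : ∀ f, (Δ.app f).left = (δ.app f).right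
  Δ_right : ∀ f, (Δ.app f).right = (μ.app f).left
  Δ_unit : ∀ f, F.L.map (F.η.app f) ≫ Δ.app f = F.η.app (F.L.obj f)
  Δ_counit : ∀ f, Δ.app f ≫ F.R.map (F.ε.app f) = F.ε.app (F.R.obj f)
  Δ_mul : ∀ f, F.L.map (μ.app f) ≫ Δ.app f =
    Δ.app (F.R.obj f) ≫ F.R.map (Δ.app f) ≫ μ.app (F.L.obj f)
  Δ_comul : ∀ f, Δ.app f ≫ F.R.map (δ.app f) =
    δ.app (F.R.obj f) ≫ F.L.map (Δ.app f) ≫ Δ.app (F.L.obj f)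

namespace AlgebraicWFS

variable {C : Type v} [Category.{w} C] {F : FunctorialFactorisation C}

/-- The comonad of an algebraic weak factorisation system. -/
def comonad (W : AlgebraicWFS F) : Comonad (Arrow C) where
  toFunctor := F.L
  ε := F.ε
  δ := W.δ
  coassoc := W.coassoc
  left_counit := W.left_counit
  right_counit := W.right_counit

/-- The monad of an algebraic weak factorisation system. -/
def monad (W : AlgebraicWFS F) : Monad (Arrow C) where
  toFunctor := F.R
  η := F.η
  μ := W.μ
  assoc := W.assoc
  left_unit := W.left_unit
  right_unit := W.right_unit

end AlgebraicWFS

/-- The functorial factorisation of `f` into the underlying map of `K f` followed by `E f`. Its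
right functor is the endofunctor `E`, which takes a square `(a, b)` to the square with top side
the body of `K (a, b)` and bottom side `b`. -/
def cellFactorisation (h : FreeProperty.{u}) : FunctorialFactorisation TopCat.{u} where
  Z := h.K ⋙ CellCx.U ⋙ Arrow.rightFunc
  i :=
    { app := fun f => (CellCx.U.obj (freeCx f)).hom
      naturality := fun f g α => by
        have h₁ := congrArg Arrow.Hom.left (h.U_map_K_map α)
        have h₂ : (CellCx.U.map (h.K.map α)).left ≫ 𝟙 g.left = 𝟙 f.left ≫ α.left := h₁
        have h₂ : (CellCx.U.map (h.K.map α)).left = α.left :=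
          (Category.comp_id _).symm.trans (h₂.trans (Category.id_comp _))
        have h₃ := Arrow.w (CellCx.U.map (h.K.map α))
        rw [h₂] at h₃
        exact h₃ }
  p :=
    { app := fun f => freeE f
      naturality := fun f g α => congrArg Arrow.Hom.right (h.U_map_K_map α) }
  fac := by
    ext1
    funext f
    exact toBody_freeE f
  hi _ := trivial
  hp _ := trivial

/-! ### Composition of cell complexes -/

namespace StrataSeq

section AddStratum

/-! A stratum `T` is composed onto a sequence of strata `Z` whose body is identified with the
boundary of `T` by a map `q` (an isomorphism in all cases of interest). -/

variable (Z : StrataSeq.{u}) (T : Stratum.{u}) (q : Z.body ⟶ T.X)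

/-- The attaching map of the cell `t` factors through the `k`-th space of `Z`. -/
def FactorsThrough (k : ℕ) (t : T.S) : Prop :=
  ∃ g : diskBoundary.{u} (T.κ t) ⟶ Z.X k, g ≫ Z.toBody k ≫ q = T.b t

/-- The cells `t` of `T` for which `k` is the smallest number such that the attaching map
factors through the `k`-th space of `Z`. -/
def NewCell (k : ℕ) : Type u :=
  { t : T.S // IsLeast { j : ℕ | Z.FactorsThrough T q j t } k }

variable {Z T q}

/-- The factorisation of the attaching map of a cell; it is unique, since the maps from the
`k`-th space of a sequence of strata to its body are injective. -/
def NewCell.lift {k : ℕ} (t : NewCell Z T q k) : diskBoundary.{u} (T.κ t.1) ⟶ Z.X k :=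
  Exists.choose t.2.1

theorem NewCell.lift_spec {k : ℕ} (t : NewCell Z T q k) :
    t.lift ≫ Z.toBody k ≫ q = T.b t.1 :=
  Exists.choose_spec t.2.1

variable (Z T q)

/-- The `k`-th space `W` of the composite, with the maps from the `k`-th space of `Z` and to the
body of `T`. -/
structure AddStage (k : ℕ) where
  W : TopCat.{u}
  j : Z.X k ⟶ W
  v : W ⟶ T.body
  comm : j ≫ v = Z.toBody k ≫ q ≫ T.incl

variable {Z T q}

namespace AddStage

variable {k : ℕ} (D : AddStage Z T q k)

/-- The `k`-th stratum of the composite: the cells are those in the `k`-th stratum of `Z`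
together with the new cells that belong to level `k`. -/
def stratum : Stratum.{u} where
  X := D.W
  S := (Z.st k).S ⊕ NewCell Z T q k
  κ := Sum.elim (Z.st k).κ (fun t => T.κ t.1)
  b
    | Sum.inl s => (Z.st k).b s ≫ D.j
    | Sum.inr t => t.lift ≫ D.j

/-- The `k`-th stratum of `Z` maps to that of the composite. -/
def inclusion : Z.st k ⟶ D.stratum where
  f := D.j
  p := Sum.inl
  hκ _ := rfl
  hb _ := (Category.id_comp _).symm

/-- The map from the body of the `k`-th stratum of the composite to the body of `T`. -/
def bodyV : D.stratum.body ⟶ T.body :=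
  D.stratum.desc D.v
    (fun
      | Sum.inl s => (Z.st k).cell s ≫ (Z.glue k).hom ≫ Z.toBody (k + 1) ≫ q ≫ T.incl
      | Sum.inr t => T.cell t.1)
    (by
      rintro (s | t)
      · change ((Z.st k).b s ≫ D.j) ≫ D.v = diskBoundaryInclusion ((Z.st k).κ s) ≫
          (Z.st k).cell s ≫ (Z.glue k).hom ≫ Z.toBody (k + 1) ≫ q ≫ T.incl
        rw [Category.assoc, D.comm, ← Z.step_toBody k, StrataSeq.step]
        have h := (Z.st k).condition s =≫ ((Z.glue k).hom ≫ Z.toBody (k + 1) ≫ q ≫ T.incl)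
        simpa only [Category.assoc] using h
      · change (t.lift ≫ D.j) ≫ D.v = diskBoundaryInclusion (T.κ t.1) ≫ T.cell t.1
        rw [Category.assoc, D.comm, ← T.condition, ← t.lift_spec]
        simp only [Category.assoc])

theorem incl_bodyV : D.stratum.incl ≫ D.bodyV = D.v := D.stratum.incl_desc D.v _ _

/-- The next space of the composite is the body of the present stratum. -/
def next : AddStage Z T q (k + 1) where
  W := D.stratum.body
  j := (Z.glue k).inv ≫ Stratum.bodyMap D.inclusion
  v := D.bodyV
  comm := by
    rw [Category.assoc, Iso.inv_comp_eq]
    apply Stratum.body_hom_ext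
    · rw [← Category.assoc, Stratum.incl_bodyMap, Category.assoc, incl_bodyV]
      have h := Z.step_toBody k =≫ (q ≫ T.incl)
      rw [StrataSeq.step] at h
      simp only [Category.assoc] at h
      rw [h]
      exact D.comm
    · intro s
      rw [← Category.assoc, Stratum.cell_bodyMap, Category.assoc]
      refine (Category.id_comp _).trans ?_
      exact D.stratum.cell_desc D.v _ _ (Sum.inl s)

end AddStage

variable (Z T q)

/-- The spaces of the composite, starting with the boundary of `Z`. -/
def addStage : ∀ k : ℕ, AddStage Z T q k
  | 0 => { W := Z.X 0, j := 𝟙 _, v := Z.toBody 0 ≫ q ≫ T.incl, comm := Category.id_comp _ }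
  | k + 1 => (addStage k).next

/-- The composite of `Z` with the stratum `T`. -/
def addStratum : StrataSeq.{u} where
  st k := (addStage Z T q k).stratum
  connected _ := rfl

/-- The canonical morphism from `Z` to the composite. -/
def toAddStratum : Z ⟶ addStratum Z T q where
  φ k := (addStage Z T q k).inclusion
  coherent k := by
    change (Z.glue k).hom ≫ (Z.glue k).inv ≫ Stratum.bodyMap (addStage Z T q k).inclusion =
      Stratum.bodyMap (addStage Z T q k).inclusion ≫ 𝟙 _
    rw [Iso.hom_inv_id_assoc, Category.comp_id]

/-- The canonical map from the body of the composite to the body of `T`. -/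
def addStratumBody : (addStratum Z T q).body ⟶ T.body :=
  (addStratum Z T q).bodyDesc (fun k => (addStage Z T q k).v) (fun k => by
    change ((addStage Z T q k).stratum.incl ≫ 𝟙 _) ≫ (addStage Z T q k).bodyV = _
    rw [Category.comp_id]
    exact (addStage Z T q k).incl_bodyV)

end AddStratum

section Stack

variable (A B : StrataSeq.{u}) (e : A.body = B.X 0)

/-- The sequence `A` with the first `n` strata of `B` composed onto it one by one, together with
the canonical map from its body to the `n`-th space of `B`. -/
def stackAux : ∀ n : ℕ, Σ Z : StrataSeq.{u}, (Z.body ⟶ B.X n)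
  | 0 => ⟨A, eqToHom e⟩
  | n + 1 =>
    ⟨addStratum (stackAux n).1 (B.st n) (stackAux n).2,
      addStratumBody (stackAux n).1 (B.st n) (stackAux n).2 ≫ (B.glue n).hom⟩

/-- The sequence `A` with the first `n` strata of `B` composed onto it. -/
def stack (n : ℕ) : StrataSeq.{u} := (stackAux A B e n).1

/-- The canonical map from the body of `stack n` to the `n`-th space of `B`. -/
def stackBody (n : ℕ) : (stack A B e n).body ⟶ B.X n := (stackAux A B e n).2

/-- The canonical morphism from each stack to the next. -/
def stackStep (n : ℕ) : stack A B e n ⟶ stack A B e (n + 1) :=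
  toAddStratum (stack A B e n) (B.st n) (stackBody A B e n)

/-- The diagram of all stacks. -/
def stackDiagram : ℕ ⥤ StrataSeq.{u} := Functor.ofSequence (stackStep A B e)

end Stack

end StrataSeq

namespace CellCx

/-- The composite of the underlying maps of two composable cell complexes. -/
def compUnderlying (A B : CellCx.{u}) (e : A.obj.body = B.obj.X 0) : Arrow TopCat.{u} :=
  Arrow.mk (A.obj.toBody 0 ≫ eqToHom e ≫ B.obj.toBody 0)

/-- A composite `B * A` of two cell complexes such that the body of `A` is the boundary of `B`:
a colimit of the sequence of stacks which is proper (so it is also their colimit among cell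
complexes), with the canonical identification of its underlying map with the composite of the
underlying maps of `A` and `B`. -/
structure Composite (A B : CellCx.{u}) (e : A.obj.body = B.obj.X 0) where
  cocone : Cocone (StrataSeq.stackDiagram A.obj B.obj e)
  isColimit : IsColimit cocone
  proper : cocone.pt.IsProper
  iso : StrataSeq.underlying.obj cocone.pt ≅ compUnderlying A B e
  iso_left : (StrataSeq.Hom.φ (cocone.ι.app 0) 0).f ≫ iso.hom.left = 𝟙 (A.obj.X 0)
  iso_right : ∀ n, StrataSeq.bodyMap (cocone.ι.app n) ≫ iso.hom.right =
    StrataSeq.stackBody A.obj B.obj e n ≫ B.obj.toBody n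

/-- The composite as a cell complex. -/
def Composite.cx {A B : CellCx.{u}} {e : A.obj.body = B.obj.X 0} (c : Composite A B e) :
    CellCx.{u} := ⟨c.cocone.pt, c.proper⟩

end CellCx

/-- The free cell complexes on `f` and on `E f` are composable; this is the type of their
composites `K E f * K f`. -/
abbrev FreeComposite (f : Arrow TopCat.{u}) :=
  CellCx.Composite (freeCx f) (freeCx (Arrow.mk (freeE f))) rfl

/-- The morphism `(1, E E f)` from the underlying map of `K E f * K f` to `f`. -/
def FreeComposite.toArrow {f : Arrow TopCat.{u}} (c : FreeComposite f) :
    CellCx.U.obj c.cx ⟶ f :=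
  c.iso.hom ≫ Arrow.homMk (u := 𝟙 f.left) (v := freeE (Arrow.mk (freeE f))) (by
    change 𝟙 f.left ≫ f.hom = ((freeSeq f).toBody 0 ≫ 𝟙 _ ≫
      (freeSeq (Arrow.mk (freeE f))).toBody 0) ≫ freeE (Arrow.mk (freeE f))
    refine (Category.id_comp _).trans ((toBody_freeE f).symm.trans ?_)
    refine .trans ?_ (Category.assoc _ _ _).symm
    exact congrArg ((freeSeq f).toBody 0 ≫ ·) (toBody_freeE (Arrow.mk (freeE f))).symm)

/-- The map from the body of `K E f` to the body of `K f` given by composition of cell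
complexes: the body part of the morphism `K E f * K f ⟶ K f` that corresponds to `(1, E E f)`. -/
def FreeComposite.mul {f : Arrow TopCat.{u}} (h : FreeProperty.{u}) (c : FreeComposite f) :
    (freeSeq (Arrow.mk (freeE f))).body ⟶ (freeSeq f).body :=
  c.iso.inv.right ≫ (CellCx.U.map (h.equiv c.cx f c.toArrow)).right

end

/-!
A cell of `K f` is determined by its attaching map and its image in the codomain of `f`, and the
stratum in which it lies is determined by its boundary in the body. Hence a map into the body of
`K f` that preserves characteristic maps of cells (a *cellular* map) is determined by its
restriction to the boundary of its source and its composite with `E f`. Every body map of a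
morphism of cell complexes is cellular, and so is `μ f`, because the cells of `K E f` are cells of
`K E f * K f`. All laws of the algebraic weak factorisation system are equations between cellular
maps into free complexes, so they follow from this uniqueness.

Attaching maps have a level because spheres are compact: a point of the body outside the boundary
is closed, so a compact subset of the body lies in some `X n`. The universal property of `K f`
rests on the fact that morphisms of strata map open cells to open cells, whence they reflect the
factorisation of maps through lower levels. The colimit of the stacks is formed stratum by
stratum, using that the body of a stratum is a left adjoint; as `U` is a left adjoint too, the
underlying map of `B * A` is the colimit of the underlying maps of the stacks.
-/

noncomputable section

/-! ### Topology of cell complexes -/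

theorem exists_subset_of_isCompact_of_coherent {X : Type*} [TopologicalSpace X] {R : ℕ → Set X}
    (mono : Monotone R) (cover : ⋃ n, R n = Set.univ)
    (coherent : ∀ C : Set X, (∀ n, IsClosed (C ∩ R n)) → IsClosed C)
    (closed_point : ∀ x ∉ R 0, IsClosed {x}) {K : Set X} (hK : IsCompact K) :
    ∃ n, K ⊆ R n := by
  -- Points of `K` outside every `R n` would form an infinite closed discrete subset of `K`.
  by_contra! h
  choose x hxK hxR using fun n => Set.not_subset.1 (h n)
  have inter_finite (C : Set X) (hC : C ⊆ Set.range x) (n : ℕ) : (C ∩ R n).Finite := by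
    refine ((Set.finite_lt_nat n).image x).subset ?_
    rintro _ ⟨hy, hyn⟩
    obtain ⟨k, rfl⟩ := hC hy
    exact ⟨k, not_le.1 fun hnk => hxR k (mono hnk hyn), rfl⟩
  have closed_subset (C : Set X) (hC : C ⊆ Set.range x) : IsClosed C := by
    refine coherent C fun n => ?_
    rw [← Set.biUnion_of_singleton (C ∩ R n)]
    refine (inter_finite C hC n).isClosed_biUnion fun y hy => closed_point y ?_
    obtain ⟨k, rfl⟩ := hC hy.1
    exact fun h0 => hxR k (mono (Nat.zero_le k) h0)
  have discrete : DiscreteTopology (Set.range x) :=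
    discreteTopology_iff_forall_isClosed.2 fun C => by
      have hC := closed_subset (Subtype.val '' C) (Subtype.coe_image_subset _ C)
      exact Set.preimage_image_eq C Subtype.val_injective ▸ hC.preimage continuous_subtype_val
  have finite : (Set.range x).Finite :=
    (hK.of_isClosed_subset (closed_subset _ subset_rfl) (Set.range_subset_iff.2 hxK)).finite
      discrete.isDiscrete
  obtain ⟨n, hn⟩ := Directed.exists_mem_subset_of_finset_subset_biUnion mono.directed_le
    (s := finite.toFinset) (by rw [cover]; exact Set.subset_univ _)
  exact hxR n (hn (finite.mem_toFinset.2 ⟨n, rfl⟩))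

theorem exists_lift_of_isEmbedding {K X Y : TopCat.{u}} {i : X ⟶ Y}
    (hi : Topology.IsEmbedding i) (g : K ⟶ Y) (h : ∀ x, g x ∈ Set.range i) :
    ∃ g' : K ⟶ X, g' ≫ i = g := by
  choose l hl using h
  have hc : Continuous l := by
    rw [hi.continuous_iff]
    exact (funext hl : i ∘ l = g) ▸ g.hom.continuous
  exact ⟨TopCat.ofHom ⟨l, hc⟩, by ext x; exact hl x⟩

instance t2Space_disk (n : ℕ) : T2Space (disk.{u} n) := by
  unfold disk; infer_instance

theorem isClosedEmbedding_diskBoundaryInclusion (n : ℕ) :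
    Topology.IsClosedEmbedding (diskBoundaryInclusion.{u} n) :=
  (diskBoundaryInclusion.{u} n).hom.continuous.isClosedEmbedding
    ((TopCat.mono_iff_injective _).1 inferInstance)

namespace Stratum

variable (P : Stratum.{u})

theorem incl_b (s : P.S) (x : diskBoundary.{u} (P.κ s)) :
    P.incl (P.b s x) = P.cell s (diskBoundaryInclusion (P.κ s) x) :=
  ConcreteCategory.congr_hom (P.condition s) x

theorem mem_range_incl_or_exists_cell (y : P.body) :
    y ∈ Set.range P.incl ∨ ∃ s x, P.cell s x = y := by
  -- All functions to an indiscrete space are continuous, so `body_hom_ext` applies to predicates.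
  let χ (p : P.body → Prop) : P.body ⟶ TopCat.trivial.obj (ULift.{u} Prop) :=
    TopCat.ofHom (Y := TopCat.trivial.obj _) ⟨fun y => ⟨p y⟩, continuous_top⟩
  have : χ (fun y => y ∈ Set.range P.incl ∨ ∃ s x, P.cell s x = y) = χ fun _ => True := by
    apply P.body_hom_ext
    · ext x
      exact congrArg ULift.up (eq_true (Or.inl ⟨x, rfl⟩))
    · intro s
      ext x
      exact congrArg ULift.up (eq_true (Or.inr ⟨s, x, rfl⟩))
  exact of_eq_true (congrArg ULift.down (ConcreteCategory.congr_hom this y))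

theorem isOpen_iff (U : Set P.body) :
    IsOpen U ↔ IsOpen (P.incl ⁻¹' U) ∧ ∀ s, IsOpen (P.cell s ⁻¹' U) := by
  refine ⟨fun h => ⟨h.preimage P.incl.hom.continuous,
    fun s => h.preimage (P.cell s).hom.continuous⟩, fun ⟨h₁, h₂⟩ => ?_⟩
  let g : P.X ⟶ TopCat.of (ULift.{u} Prop) := TopCat.ofHom
    ⟨fun x => ⟨P.incl x ∈ U⟩, continuous_uliftUp.comp (continuous_Prop.2 h₁)⟩
  let c (s : P.S) : disk.{u} (P.κ s) ⟶ TopCat.of (ULift.{u} Prop) := TopCat.ofHom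
    ⟨fun x => ⟨P.cell s x ∈ U⟩, continuous_uliftUp.comp (continuous_Prop.2 (h₂ s))⟩
  have w (s : P.S) : P.b s ≫ g = diskBoundaryInclusion (P.κ s) ≫ c s := by
    ext x
    exact iff_of_eq (congrArg (· ∈ U) (P.incl_b s x))
  have desc_eq (y : P.body) : (P.desc g c w y).down = (y ∈ U) := by
    obtain ⟨x, rfl⟩ | ⟨s, x, rfl⟩ := P.mem_range_incl_or_exists_cell y
    · exact congrArg ULift.down (ConcreteCategory.congr_hom (P.incl_desc g c w) x)
    · exact congrArg ULift.down (ConcreteCategory.congr_hom (P.cell_desc g c w s) x)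
  have hc : Continuous fun y => y ∈ U := by
    simpa only [Function.comp_def, desc_eq] using
      continuous_uliftDown.comp (P.desc g c w).hom.continuous
  exact continuous_Prop.1 hc

theorem isClosed_iff (C : Set P.body) :
    IsClosed C ↔ IsClosed (P.incl ⁻¹' C) ∧ ∀ s, IsClosed (P.cell s ⁻¹' C) := by
  simp only [← isOpen_compl_iff, P.isOpen_iff, Set.preimage_compl]

open Classical in
theorem exists_separating_function : ∃ F : P.body → P.X ⊕ Σ s : P.S, disk.{u} (P.κ s),
    (∀ x, F (P.incl x) = Sum.inl x) ∧
    ∀ s x, x ∉ Set.range (diskBoundaryInclusion (P.κ s)) → F (P.cell s x) = Sum.inr ⟨s, x⟩ := by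
  let W : TopCat.{u} := TopCat.trivial.obj (P.X ⊕ Σ s : P.S, disk.{u} (P.κ s))
  let g : P.X ⟶ W := TopCat.ofHom (Y := W) ⟨Sum.inl, continuous_top⟩
  let c (s : P.S) : disk.{u} (P.κ s) ⟶ W := TopCat.ofHom (Y := W)
    ⟨fun x => if h : x ∈ Set.range (diskBoundaryInclusion (P.κ s)) then
      Sum.inl (P.b s h.choose) else Sum.inr ⟨s, x⟩, continuous_top⟩
  have w (s : P.S) : P.b s ≫ g = diskBoundaryInclusion (P.κ s) ≫ c s := by
    ext x
    have h : diskBoundaryInclusion (P.κ s) x ∈ Set.range (diskBoundaryInclusion.{u} (P.κ s)) :=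
      ⟨x, rfl⟩
    have hx : h.choose = x :=
      (isClosedEmbedding_diskBoundaryInclusion (P.κ s)).injective h.choose_spec
    exact ((dif_pos h).trans (by rw [hx]; rfl)).symm
  refine ⟨P.desc g c w, fun x => ?_, fun s x hx => ?_⟩
  · exact ConcreteCategory.congr_hom (P.incl_desc g c w) x
  · exact (ConcreteCategory.congr_hom (P.cell_desc g c w s) x).trans (dif_neg hx)

theorem incl_injective : Function.Injective P.incl := by
  obtain ⟨F, F_incl, -⟩ := P.exists_separating_function
  intro x y h
  simpa only [F_incl, Sum.inl.injEq] using congrArg F h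

theorem cell_mem_range_incl_iff (s : P.S) (x : disk.{u} (P.κ s)) :
    P.cell s x ∈ Set.range P.incl ↔ x ∈ Set.range (diskBoundaryInclusion (P.κ s)) := by
  constructor
  · rintro ⟨y, hy⟩
    by_contra hx
    obtain ⟨F, F_incl, F_cell⟩ := P.exists_separating_function
    simpa only [F_incl, F_cell s x hx, reduceCtorEq] using congrArg F hy
  · rintro ⟨y, rfl⟩
    exact ⟨_, P.incl_b s y⟩

theorem cell_preimage_incl_image (s : P.S) (C : Set P.X) :
    P.cell s ⁻¹' (P.incl '' C) = diskBoundaryInclusion (P.κ s) '' (P.b s ⁻¹' C) := by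
  ext x
  constructor
  · rintro ⟨y, hy, hyx⟩
    obtain ⟨z, rfl⟩ := (P.cell_mem_range_incl_iff s x).1 ⟨y, hyx⟩
    obtain rfl : y = P.b s z := P.incl_injective (hyx.trans (P.incl_b s z).symm)
    exact ⟨z, hy, rfl⟩
  · rintro ⟨z, hz, rfl⟩
    exact ⟨_, hz, P.incl_b s z⟩

theorem isClosedEmbedding_incl : Topology.IsClosedEmbedding P.incl := by
  refine .of_continuous_injective_isClosedMap P.incl.hom.continuous P.incl_injective ?_
  intro C hC
  refine (P.isClosed_iff _).2 ⟨by rwa [Set.preimage_image_eq _ P.incl_injective], fun s => ?_⟩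
  rw [cell_preimage_incl_image]
  exact (isClosedEmbedding_diskBoundaryInclusion _).isClosedMap _
    (hC.preimage (P.b s).hom.continuous)

theorem cell_inj_of_notMem_range_incl {s t : P.S} {x : disk.{u} (P.κ s)} {y : disk.{u} (P.κ t)}
    (hx : P.cell s x ∉ Set.range P.incl) (h : P.cell s x = P.cell t y) :
    (⟨s, x⟩ : Σ s : P.S, disk.{u} (P.κ s)) = ⟨t, y⟩ := by
  have hy : P.cell t y ∉ Set.range P.incl := h ▸ hx
  obtain ⟨F, -, F_cell⟩ := P.exists_separating_function
  have := congrArg F h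
  rwa [F_cell s x fun hb => hx ((P.cell_mem_range_incl_iff s x).2 hb),
    F_cell t y fun hb => hy ((P.cell_mem_range_incl_iff t y).2 hb), Sum.inr.injEq] at this

theorem isClosed_singleton {y : P.body} (hy : y ∉ Set.range P.incl) : IsClosed {y} := by
  refine (P.isClosed_iff _).2 ⟨?_, fun s => Set.Subsingleton.isClosed fun z hz w hw => ?_⟩
  · convert isClosed_empty
    exact Set.eq_empty_of_forall_notMem fun z hz => hy ⟨z, hz⟩
  · have hz : P.cell s z = y := hz
    simpa using P.cell_inj_of_notMem_range_incl (hz ▸ hy) (hz.trans (Eq.symm hw))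

theorem eqToHom_mem_range_diskBoundaryInclusion {m n : ℕ} (h : m = n) (x : disk.{u} m) :
    eqToHom (congrArg disk.{u} h) x ∈ Set.range (diskBoundaryInclusion.{u} n) ↔
      x ∈ Set.range (diskBoundaryInclusion.{u} m) := by
  subst h; rfl

variable {P} {Q : Stratum.{u}}

theorem mem_range_incl_of_bodyMap (φ : P ⟶ Q) {y : P.body}
    (hy : bodyMap φ y ∈ Set.range Q.incl) : y ∈ Set.range P.incl := by
  obtain hx | ⟨s, x, rfl⟩ := P.mem_range_incl_or_exists_cell y
  · exact hx
  have h : bodyMap φ (P.cell s x) = Q.cell (φ.p s) (eqToHom (congrArg disk (φ.hκ s)) x) :=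
    ConcreteCategory.congr_hom (cell_bodyMap φ s) x
  rw [h, cell_mem_range_incl_iff, eqToHom_mem_range_diskBoundaryInclusion (φ.hκ s)] at hy
  exact (P.cell_mem_range_incl_iff s x).2 hy

theorem exists_factor_of_bodyMap (φ : P ⟶ Q) {K : TopCat.{u}} (g : K ⟶ P.body)
    (h : ∃ g', g' ≫ Q.incl = g ≫ bodyMap φ) : ∃ g', g' ≫ P.incl = g := by
  obtain ⟨g', hg⟩ := h
  exact exists_lift_of_isEmbedding P.isClosedEmbedding_incl.isEmbedding g fun x =>
    mem_range_incl_of_bodyMap φ ⟨g' x, ConcreteCategory.congr_hom hg x⟩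

end Stratum

namespace StrataSeq

variable (A : StrataSeq.{u})

theorem trans_self (n : ℕ) : A.trans (le_refl n) = 𝟙 _ := A.diagram.map_id n

theorem trans_toBody {m n : ℕ} (h : m ≤ n) : A.trans h ≫ A.toBody n = A.toBody m :=
  colimit.w A.diagram (homOfLE h)

theorem toBody_trans_apply {m n : ℕ} (h : m ≤ n) (x : A.X m) :
    A.toBody n (A.trans h x) = A.toBody m x :=
  ConcreteCategory.congr_hom (A.trans_toBody h) x

theorem isClosedEmbedding_step (n : ℕ) : Topology.IsClosedEmbedding (A.step n) :=
  (homeoOfIso (A.glue n)).isClosedEmbedding.comp (A.st n).isClosedEmbedding_incl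

theorem isClosedEmbedding_trans {m n : ℕ} (h : m ≤ n) :
    Topology.IsClosedEmbedding (A.trans h) := by
  induction n, h using Nat.le_induction with
  | base => rw [trans_self]; exact .id
  | succ n h ih => rw [trans_succ A h]; exact (A.isClosedEmbedding_step n).comp ih

theorem toBody_injective (n : ℕ) : Function.Injective (A.toBody n) := by
  intro x y h
  obtain ⟨k, f, _, hk⟩ := Concrete.colimit_exists_of_rep_eq A.diagram x y h
  exact (A.isClosedEmbedding_trans (leOfHom f)).injective hk

instance mono_toBody (n : ℕ) : Mono (A.toBody n) :=
  (TopCat.mono_iff_injective _).2 (A.toBody_injective n)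

theorem isClosed_iff (C : Set A.body) : IsClosed C ↔ ∀ n, IsClosed (A.toBody n ⁻¹' C) :=
  TopCat.isClosed_iff_of_isColimit _ (colimit.isColimit A.diagram) C

theorem isClosedEmbedding_toBody (n : ℕ) : Topology.IsClosedEmbedding (A.toBody n) := by
  refine .of_continuous_injective_isClosedMap (A.toBody n).hom.continuous
    (A.toBody_injective n) fun C hC => (A.isClosed_iff _).2 fun m => ?_
  have preimage_eq : A.toBody m ⁻¹' (A.toBody n '' C) =
      A.trans (le_max_left m n) ⁻¹' (A.trans (le_max_right m n) '' C) := by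
    ext x
    refine exists_congr fun y => and_congr_right fun _ => ?_
    rw [← (A.toBody_injective (max m n)).eq_iff, toBody_trans_apply, toBody_trans_apply]
  rw [preimage_eq]
  exact ((A.isClosedEmbedding_trans _).isClosedMap _ hC).preimage
    (A.trans (le_max_left m n)).hom.continuous

theorem range_toBody_mono : Monotone fun n => Set.range (A.toBody n) := by
  rintro m n h _ ⟨x, rfl⟩
  exact ⟨_, A.toBody_trans_apply h x⟩

theorem glue_mem_range_step_iff {n : ℕ} (y : (A.st n).body) :
    (A.glue n).hom y ∈ Set.range (A.step n) ↔ y ∈ Set.range (A.st n).incl :=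
  exists_congr fun _ => (homeoOfIso (A.glue n)).injective.eq_iff

theorem isClosed_singleton {y : A.body} (hy : y ∉ Set.range (A.toBody 0)) : IsClosed {y} := by
  obtain ⟨n, x, rfl⟩ := Concrete.colimit_exists_rep A.diagram y
  change A.toBody n x ∉ _ at hy
  change IsClosed {A.toBody n x}
  induction n with
  | zero => exact absurd ⟨x, rfl⟩ hy
  | succ n ih =>
    by_cases hx : x ∈ Set.range (A.step n)
    · obtain ⟨z, rfl⟩ := hx
      have h : A.toBody (n + 1) (A.step n z) = A.toBody n z :=
        ConcreteCategory.congr_hom (A.step_toBody n) z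
      rw [h] at hy ⊢
      exact ih z hy
    · obtain ⟨z, rfl⟩ := (homeoOfIso (A.glue n)).surjective x
      have hz := (A.st n).isClosed_singleton (mt (A.glue_mem_range_step_iff z).2 hx)
      simpa only [Set.image_singleton] using (A.isClosedEmbedding_toBody (n + 1)).isClosedMap _
        ((homeoOfIso (A.glue n)).isClosedMap _ hz)

theorem exists_factor_of_compactSpace {K : TopCat.{u}} [CompactSpace K] (g : K ⟶ A.body) :
    ∃ (n : ℕ) (g' : K ⟶ A.X n), g' ≫ A.toBody n = g := by
  obtain ⟨n, hn⟩ := exists_subset_of_isCompact_of_coherent A.range_toBody_mono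
    (Set.eq_univ_of_forall fun y =>
      Set.mem_iUnion.2 (Concrete.colimit_exists_rep A.diagram y))
    (fun C hC => (A.isClosed_iff C).2 fun n => by
      simpa only [Set.preimage_inter_range] using (hC n).preimage (A.toBody n).hom.continuous)
    (fun _ => A.isClosed_singleton) (isCompact_range g.hom.continuous)
  exact ⟨n, exists_lift_of_isEmbedding (A.isClosedEmbedding_toBody n).isEmbedding g
    (Set.range_subset_iff.1 hn)⟩

variable {A} {B : StrataSeq.{u}}

theorem mem_range_step_of_map (φ : A ⟶ B) {n : ℕ} {y : A.X (n + 1)}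
    (h : (φ.φ (n + 1)).f y ∈ Set.range (B.step n)) : y ∈ Set.range (A.step n) := by
  obtain ⟨z, rfl⟩ := (homeoOfIso (A.glue n)).surjective y
  have hc : (φ.φ (n + 1)).f ((A.glue n).hom z) = (B.glue n).hom (Stratum.bodyMap (φ.φ n) z) :=
    ConcreteCategory.congr_hom (φ.coherent n) z
  refine (A.glue_mem_range_step_iff z).2 (Stratum.mem_range_incl_of_bodyMap (φ.φ n) ?_)
  rw [← B.glue_mem_range_step_iff, ← hc]
  exact h

theorem mem_range_trans_of_map (φ : A ⟶ B) {m n : ℕ} (h : m ≤ n) {y : A.X n}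
    (hy : (φ.φ n).f y ∈ Set.range (B.trans h)) : y ∈ Set.range (A.trans h) := by
  induction n, h using Nat.le_induction with
  | base => rw [trans_self]; exact ⟨y, rfl⟩
  | succ n h ih =>
    rw [trans_succ B h] at hy
    obtain ⟨z, hz⟩ := hy
    obtain ⟨y, rfl⟩ := mem_range_step_of_map φ ⟨_, hz⟩
    have hs : (φ.φ (n + 1)).f (A.step n y) = B.step n ((φ.φ n).f y) :=
      ConcreteCategory.congr_hom (step_naturality φ n) y
    rw [hs] at hz
    obtain ⟨x, rfl⟩ := ih ⟨z, (B.isClosedEmbedding_step n).injective hz⟩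
    rw [trans_succ A h]
    exact ⟨x, rfl⟩

theorem exists_factor_of_map (φ : A ⟶ B) {m n : ℕ} (h : m ≤ n) {K : TopCat.{u}} (g : K ⟶ A.X n)
    (hg : ∃ g', g' ≫ B.trans h = g ≫ (φ.φ n).f) : ∃ g', g' ≫ A.trans h = g := by
  obtain ⟨g', hg⟩ := hg
  exact exists_lift_of_isEmbedding (A.isClosedEmbedding_trans h).isEmbedding g fun x =>
    mem_range_trans_of_map φ h ⟨_, ConcreteCategory.congr_hom hg x⟩

end StrataSeq

namespace StrataSeq

variable (A : StrataSeq.{u})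

/-- The characteristic map of a cell of a sequence of strata, as a map to its body. -/
def char (n : ℕ) (s : (A.st n).S) : disk.{u} ((A.st n).κ s) ⟶ A.body :=
  (A.st n).cell s ≫ (A.glue n).hom ≫ A.toBody (n + 1)

theorem incl_glue_toBody (n : ℕ) :
    (A.st n).incl ≫ (A.glue n).hom ≫ A.toBody (n + 1) = A.toBody n :=
  (Category.assoc _ _ _).symm.trans (A.step_toBody n)

theorem boundary_char (n : ℕ) (s : (A.st n).S) :
    diskBoundaryInclusion ((A.st n).κ s) ≫ A.char n s = (A.st n).b s ≫ A.toBody n := by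
  rw [char, ← reassoc_of% (A.st n).condition s, incl_glue_toBody]

theorem body_hom_ext_of_boundary {W : TopCat.{u}} {g h : A.body ⟶ W}
    (h₀ : A.toBody 0 ≫ g = A.toBody 0 ≫ h)
    (H : ∀ n s, diskBoundaryInclusion ((A.st n).κ s) ≫ A.char n s ≫ g =
      diskBoundaryInclusion ((A.st n).κ s) ≫ A.char n s ≫ h → A.char n s ≫ g = A.char n s ≫ h) :
    g = h := by
  refine A.body_hom_ext fun n => ?_
  induction n with
  | zero => exact h₀
  | succ n ih =>
    rw [← cancel_epi (A.glue n).hom]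
    refine (A.st n).body_hom_ext ?_ fun s => ?_
    · rw [reassoc_of% A.incl_glue_toBody n, reassoc_of% A.incl_glue_toBody n, ih]
    · have hs := H n s (by
        rw [reassoc_of% A.boundary_char n s, reassoc_of% A.boundary_char n s, ih])
      simpa only [char, Category.assoc] using hs

theorem bodyMap_glue_toBody_assoc {A B : StrataSeq.{u}} (φ : A ⟶ B) (n : ℕ) {W : TopCat.{u}}
    (g : B.body ⟶ W) :
    Stratum.bodyMap (φ.φ n) ≫ (B.glue n).hom ≫ B.toBody (n + 1) ≫ g =
      (A.glue n).hom ≫ A.toBody (n + 1) ≫ bodyMap φ ≫ g := by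
  rw [reassoc_of% toBody_bodyMap φ (n + 1), reassoc_of% φ.coherent n]

theorem char_bodyMap {A B : StrataSeq.{u}} (φ : A ⟶ B) (n : ℕ) (s : (A.st n).S) :
    A.char n s ≫ bodyMap φ =
      eqToHom (congrArg disk.{u} ((φ.φ n).hκ s)) ≫ B.char n ((φ.φ n).p s) := by
  simp only [char, Category.assoc, toBody_bodyMap]
  rw [reassoc_of% φ.coherent n, reassoc_of% Stratum.cell_bodyMap (φ.φ n) s]

theorem IsProper.not_exists_factor_step {A : StrataSeq.{u}} (hA : A.IsProper) {n : ℕ}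
    (s : (A.st (n + 1)).S) : ¬ ∃ g, g ≫ A.step n = (A.st (n + 1)).b s := by
  rintro ⟨g, hg⟩
  refine hA (n + 1) s n n.lt_succ_self ⟨g, ?_⟩
  rw [A.trans_succ le_rfl, A.trans_self, Category.id_comp, hg]

end StrataSeq

/-! ### The universal property of free cell complexes -/

namespace FreeStage

variable {B : TopCat.{u}} (F : FreeStage.{u} B) {P : Stratum.{u}}

/-- The map to `B` from the body of the stratum of a stage over `B`. -/
def bodyE : F.stratum.body ⟶ B := F.next.e

theorem incl_bodyE : F.stratum.incl ≫ F.bodyE = F.e :=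
  F.stratum.incl_desc _ _ fun s => Arrow.w s.1.2

theorem cell_bodyE (s : F.stratum.S) : F.stratum.cell s ≫ F.bodyE = s.1.2.right :=
  F.stratum.cell_desc _ _ (fun s => Arrow.w s.1.2) s

theorem cell_ext {s t : F.stratum.S} {d : ℕ} (hs : d = F.stratum.κ s) (ht : d = F.stratum.κ t)
    (hb : eqToHom (congrArg diskBoundary.{u} hs) ≫ F.stratum.b s =
      eqToHom (congrArg diskBoundary.{u} ht) ≫ F.stratum.b t)
    (he : eqToHom (congrArg disk.{u} hs) ≫ F.stratum.cell s ≫ F.bodyE =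
      eqToHom (congrArg disk.{u} ht) ≫ F.stratum.cell t ≫ F.bodyE) : s = t := by
  rw [cell_bodyE, cell_bodyE] at he
  obtain ⟨⟨m, a⟩, ha⟩ := s
  obtain ⟨⟨n, b⟩, hb'⟩ := t
  obtain rfl : d = m := hs
  obtain rfl : d = n := ht
  obtain rfl : a = b := Arrow.hom_ext _ _
    ((Category.id_comp _).symm.trans (hb.trans (Category.id_comp _)))
    ((Category.id_comp _).symm.trans (he.trans (Category.id_comp _)))
  rfl

theorem hom_ext {φ ψ : P ⟶ F.stratum} (h : φ.f = ψ.f)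
    (he : Stratum.bodyMap φ ≫ F.bodyE = Stratum.bodyMap ψ ≫ F.bodyE) : φ = ψ := by
  refine Stratum.hom_ext h (funext fun s => F.cell_ext (φ.hκ s) (ψ.hκ s) ?_ ?_)
  · rw [← φ.hb s, h, ψ.hb s]
  · have hs := P.cell s ≫= he
    rwa [reassoc_of% Stratum.cell_bodyMap φ s, reassoc_of% Stratum.cell_bodyMap ψ s] at hs

section Lift

variable (g : P.X ⟶ F.X) (r : P.body ⟶ B) (w : g ≫ F.e = P.incl ≫ r)
  (proper : ∀ s, ¬ F.improper (P.κ s) (P.b s ≫ g))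

/-- The morphism of strata to a stage of a free cell complex that is `g` on the boundary and lies
over the map `r` from the body. -/
def lift : P ⟶ F.stratum where
  f := g
  p s := ⟨⟨P.κ s, Arrow.homMk (u := P.b s ≫ g) (v := P.cell s ≫ r) (by
    change (P.b s ≫ g) ≫ F.e = diskBoundaryInclusion (P.κ s) ≫ P.cell s ≫ r
    rw [Category.assoc, w, reassoc_of% P.condition s])⟩, proper s⟩
  hκ _ := rfl
  hb _ := (Category.id_comp _).symm

theorem bodyMap_lift_bodyE : Stratum.bodyMap (F.lift g r w proper) ≫ F.bodyE = r := by
  refine P.body_hom_ext ?_ fun s => ?_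
  · rw [reassoc_of% Stratum.incl_bodyMap (F.lift g r w proper), incl_bodyE]
    exact w
  · rw [reassoc_of% Stratum.cell_bodyMap (F.lift g r w proper) s, cell_bodyE]
    exact Category.id_comp _

end Lift

end FreeStage

theorem toBody_freeE_stage (f : Arrow TopCat.{u}) (n : ℕ) :
    (freeSeq f).toBody n ≫ freeE f = (freeStage f n).e :=
  (freeSeq f).toBody_bodyDesc (fun n => (freeStage f n).e) _ n

theorem glue_toBody_freeE (f : Arrow TopCat.{u}) (n : ℕ) :
    ((freeSeq f).glue n).hom ≫ (freeSeq f).toBody (n + 1) ≫ freeE f = (freeStage f n).bodyE :=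
  (Category.id_comp _).trans (toBody_freeE_stage f (n + 1))

theorem freeSeq_stratum_hom_ext {f : Arrow TopCat.{u}} {n : ℕ} {P : Stratum.{u}}
    {φ ψ : P ⟶ (freeSeq f).st n} (h : φ.f = ψ.f)
    (he : Stratum.bodyMap φ ≫ ((freeSeq f).glue n).hom ≫ (freeSeq f).toBody (n + 1) ≫ freeE f =
      Stratum.bodyMap ψ ≫ ((freeSeq f).glue n).hom ≫ (freeSeq f).toBody (n + 1) ≫ freeE f) :
    φ = ψ :=
  (freeStage f n).hom_ext h (by rwa [glue_toBody_freeE] at he)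

/-- A lift to the `n`-th stage of the free cell complex on `f` of a map `r` from the body of a
sequence of strata to the codomain of `f`. -/
structure FreeLift (C : StrataSeq.{u}) (f : Arrow TopCat.{u}) (r : C.body ⟶ f.right) (n : ℕ) where
  g : C.X n ⟶ (freeStage f n).X
  comm : g ≫ (freeStage f n).e = C.toBody n ≫ r
  proper : ∀ s : (C.st n).S, ¬ (freeStage f n).improper ((C.st n).κ s) ((C.st n).b s ≫ g)

namespace FreeLift

variable {C : StrataSeq.{u}} {f : Arrow TopCat.{u}} {r : C.body ⟶ f.right} {n : ℕ}

/-- The morphism of strata over `r` that extends a lift. -/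
def hom (D : FreeLift C f r n) : C.st n ⟶ ((freeSeq f).st n) :=
  (freeStage f n).lift D.g ((C.glue n).hom ≫ C.toBody (n + 1) ≫ r)
    (by rw [D.comm, reassoc_of% C.incl_glue_toBody n]) D.proper

/-- The lift to the next stage: an attaching map cannot become improper, because morphisms of
strata reflect the factorisation of maps through the boundary. -/
def next (hC : C.IsProper) (D : FreeLift C f r n) : FreeLift C f r (n + 1) where
  g := (C.glue n).inv ≫ Stratum.bodyMap D.hom
  comm := by
    rw [← cancel_epi (C.glue n).hom]
    exact (Iso.hom_inv_id_assoc _ _).trans ((freeStage f n).bodyMap_lift_bodyE _ _ _ _)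
  proper s h := by
    obtain ⟨g, hg⟩ := Stratum.exists_factor_of_bodyMap D.hom
      ((C.st (n + 1)).b s ≫ (C.glue n).inv) (by rw [Category.assoc]; exact h)
    refine hC.not_exists_factor_step s ⟨g, ?_⟩
    rw [StrataSeq.step, reassoc_of% hg, Iso.inv_hom_id, Category.comp_id]

end FreeLift

section FreeProperty

variable {C : StrataSeq.{u}} (hC : C.IsProper) {f : Arrow TopCat.{u}}
  (α : StrataSeq.underlying.obj C ⟶ f)

/-- The lifts to all stages of the free cell complex on `f` of a map of arrows with codomain `f`.
-/
def freeLift : ∀ n, FreeLift C f α.right n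
  | 0 => { g := α.left, comm := Arrow.w α, proper := fun _ h => h }
  | n + 1 => (freeLift n).next hC

/-- The morphism to the free cell complex on `f` that corresponds to a map of arrows with
codomain `f`. -/
def freeLiftHom : C ⟶ freeSeq f where
  φ n := (freeLift hC α n).hom
  coherent _ := (Iso.hom_inv_id_assoc _ _).trans (Category.comp_id _).symm

theorem bodyMap_freeLiftHom : StrataSeq.bodyMap (freeLiftHom hC α) ≫ freeE f = α.right := by
  refine C.body_hom_ext fun n => ?_
  rw [reassoc_of% StrataSeq.toBody_bodyMap (freeLiftHom hC α) n, toBody_freeE_stage]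
  exact (freeLift hC α n).comm

theorem freeSeq_hom_ext {φ ψ : C ⟶ freeSeq f} (h₀ : (φ.φ 0).f = (ψ.φ 0).f)
    (h : StrataSeq.bodyMap φ ≫ freeE f = StrataSeq.bodyMap ψ ≫ freeE f) : φ = ψ := by
  have hom_eq (n : ℕ) (hn : (φ.φ n).f = (ψ.φ n).f) : φ.φ n = ψ.φ n :=
    freeSeq_stratum_hom_ext hn (by
      rw [StrataSeq.bodyMap_glue_toBody_assoc, StrataSeq.bodyMap_glue_toBody_assoc, h])
  refine StrataSeq.hom_ext fun n => hom_eq n ?_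
  induction n with
  | zero => exact h₀
  | succ n ih => rw [← cancel_epi (C.glue n).hom, φ.coherent, ψ.coherent, hom_eq n ih]

end FreeProperty

theorem freeProperty : FreeProperty.{u} := by
  intro C f α
  refine ⟨ObjectProperty.homMk (freeLiftHom C.property α), ?_, fun ψ hψ => ?_⟩
  · exact Arrow.hom_ext _ _ (Category.comp_id _) (bodyMap_freeLiftHom C.property α)
  · refine ObjectProperty.hom_ext _ (freeSeq_hom_ext ?_ ?_)
    · exact (Category.comp_id _).symm.trans (congrArg Arrow.Hom.left hψ)
    · exact (congrArg Arrow.Hom.right hψ).trans (bodyMap_freeLiftHom C.property α).symm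

/-! ### Composing strata onto a cell complex -/

namespace StrataSeq

section AddStratum

variable (Z : StrataSeq.{u}) (T : Stratum.{u}) (q : Z.body ⟶ T.X)

theorem addStratum_isProper (hZ : Z.IsProper) : (addStratum Z T q).IsProper := by
  rintro n (s | t) m h hg
  · exact hZ n s m h (exists_factor_of_map (toAddStratum Z T q) h.le ((Z.st n).b s) hg)
  · obtain ⟨g, hg⟩ := exists_factor_of_map (toAddStratum Z T q) h.le t.lift hg
    refine absurd (t.2.2 (show Z.FactorsThrough T q m t.1 from ⟨g, ?_⟩)) h.not_ge
    rw [← t.lift_spec, ← hg, Category.assoc, reassoc_of% Z.trans_toBody h.le]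

theorem toBody_addStratumBody (k : ℕ) :
    (addStratum Z T q).toBody k ≫ addStratumBody Z T q = (addStage Z T q k).v :=
  toBody_bodyDesc _ _ _ k

theorem bodyMap_addStratumBody :
    bodyMap (toAddStratum Z T q) ≫ addStratumBody Z T q = q ≫ T.incl := by
  refine Z.body_hom_ext fun k => ?_
  rw [reassoc_of% toBody_bodyMap (toAddStratum Z T q) k, toBody_addStratumBody]
  exact (addStage Z T q k).comm

theorem char_inl (k : ℕ) (s : (Z.st k).S) :
    (addStratum Z T q).char k (Sum.inl s) = Z.char k s ≫ bodyMap (toAddStratum Z T q) :=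
  ((char_bodyMap (toAddStratum Z T q) k s).trans (Category.id_comp _)).symm

variable {Z T q}

theorem AddStage.cell_bodyV {k : ℕ} (D : AddStage Z T q k) (t : NewCell Z T q k) :
    D.stratum.cell (Sum.inr t) ≫ D.bodyV = T.cell t.1 :=
  D.stratum.cell_desc _ _ _ (Sum.inr t)

/-- The characteristic map of a new cell of the composite. -/
def NewCell.char {k : ℕ} (t : NewCell Z T q k) : disk.{u} (T.κ t.1) ⟶ (addStratum Z T q).body :=
  (addStratum Z T q).char k (Sum.inr t)

theorem NewCell.char_addStratumBody {k : ℕ} (t : NewCell Z T q k) :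
    t.char ≫ addStratumBody Z T q = T.cell t.1 := by
  have hv : ((addStratum Z T q).glue k).hom ≫ (addStratum Z T q).toBody (k + 1) ≫
      addStratumBody Z T q = (addStage Z T q k).bodyV :=
    (Category.id_comp _).trans (toBody_addStratumBody Z T q (k + 1))
  refine .trans ?_ ((addStage Z T q k).cell_bodyV t)
  refine .trans ?_ (congrArg (((addStratum Z T q).st k).cell (Sum.inr t) ≫ ·) hv)
  exact (Category.assoc _ _ _).trans (congrArg (_ ≫ ·) (Category.assoc _ _ _))

theorem NewCell.char_congr {k k' : ℕ} (t : NewCell Z T q k) (t' : NewCell Z T q k')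
    (h : t.1 = t'.1) :
    t.char = eqToHom (congrArg (fun s => disk.{u} (T.κ s)) h) ≫ t'.char := by
  obtain ⟨t, ht⟩ := t
  obtain ⟨t', ht'⟩ := t'
  obtain rfl : t = t' := h
  obtain rfl : k = k' := ht.unique ht'
  exact (Category.id_comp _).symm

variable [IsIso q]

theorem NewCell.boundary_char {k : ℕ} (t : NewCell Z T q k) :
    T.b t.1 ≫ inv q ≫ bodyMap (toAddStratum Z T q) =
      diskBoundaryInclusion (T.κ t.1) ≫ t.char := by
  rw [← t.lift_spec, Category.assoc, Category.assoc, IsIso.hom_inv_id_assoc, toBody_bodyMap]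
  exact (((addStratum Z T q).boundary_char k (Sum.inr t)).trans (Category.assoc _ _ _)).symm

theorem isLeast_sInf_factorsThrough (t : T.S) :
    IsLeast { j : ℕ | Z.FactorsThrough T q j t } (sInf { j : ℕ | Z.FactorsThrough T q j t }) := by
  obtain ⟨n, g, hg⟩ := Z.exists_factor_of_compactSpace (T.b t ≫ inv q)
  have hne : { j : ℕ | Z.FactorsThrough T q j t }.Nonempty :=
    ⟨n, g, by rw [reassoc_of% hg, IsIso.inv_hom_id, Category.comp_id]⟩
  exact ⟨Nat.sInf_mem hne, fun _ hj => Nat.sInf_le hj⟩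

variable (q) in
/-- The new cell of the composite that corresponds to a cell of the stratum. -/
def newCell (t : T.S) : NewCell Z T q (sInf { j : ℕ | Z.FactorsThrough T q j t }) :=
  ⟨t, isLeast_sInf_factorsThrough t⟩

variable (q) in
/-- The inverse of the canonical map from the body of the composite to the body of the stratum. -/
def addStratumBodyInv : T.body ⟶ (addStratum Z T q).body :=
  T.desc (inv q ≫ bodyMap (toAddStratum Z T q)) (fun t => (newCell q t).char) fun t =>
    (newCell q t).boundary_char

theorem incl_addStratumBodyInv :
    T.incl ≫ addStratumBodyInv q = inv q ≫ bodyMap (toAddStratum Z T q) :=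
  T.incl_desc _ _ _

theorem cell_addStratumBodyInv (t : T.S) :
    T.cell t ≫ addStratumBodyInv q = (newCell q t).char :=
  T.cell_desc _ _ _ t

theorem addStratumBodyInv_addStratumBody :
    addStratumBodyInv q ≫ addStratumBody Z T q = 𝟙 T.body := by
  refine T.body_hom_ext ?_ fun t => ?_
  · rw [reassoc_of% incl_addStratumBodyInv, bodyMap_addStratumBody, IsIso.inv_hom_id_assoc,
      Category.comp_id]
  · rw [reassoc_of% cell_addStratumBodyInv t, Category.comp_id]
    exact (newCell q t).char_addStratumBody

theorem comp_bodyMap_addStratumBody_addStratumBodyInv {K : TopCat.{u}} (a : K ⟶ Z.body) :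
    (a ≫ bodyMap (toAddStratum Z T q)) ≫ addStratumBody Z T q ≫ addStratumBodyInv q =
      (a ≫ bodyMap (toAddStratum Z T q)) ≫ 𝟙 _ := by
  rw [Category.assoc, reassoc_of% bodyMap_addStratumBody, incl_addStratumBodyInv,
    IsIso.hom_inv_id_assoc, Category.comp_id]

theorem addStratumBody_addStratumBodyInv :
    addStratumBody Z T q ≫ addStratumBodyInv q = 𝟙 (addStratum Z T q).body := by
  refine body_hom_ext_of_boundary _ ?_ ?_
  · have h : (addStratum Z T q).toBody 0 = Z.toBody 0 ≫ bodyMap (toAddStratum Z T q) :=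
      ((toBody_bodyMap (toAddStratum Z T q) 0).trans (Category.id_comp _)).symm
    rw [h]
    exact comp_bodyMap_addStratumBody_addStratumBodyInv (Z.toBody 0)
  · rintro n (s | t) -
    · rw [char_inl]
      exact comp_bodyMap_addStratumBody_addStratumBodyInv (Z.char n s)
    · change t.char ≫ addStratumBody Z T q ≫ addStratumBodyInv q = t.char ≫ 𝟙 _
      rw [reassoc_of% t.char_addStratumBody, cell_addStratumBodyInv,
        (newCell q t.1).char_congr t rfl, Category.comp_id]
      exact Category.id_comp _

instance isIso_addStratumBody : IsIso (addStratumBody Z T q) :=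
  ⟨addStratumBodyInv q, addStratumBody_addStratumBodyInv, addStratumBodyInv_addStratumBody⟩

end AddStratum

section Stack

variable (A B : StrataSeq.{u}) (e : A.body = B.X 0)

theorem stack_isProper (hA : A.IsProper) (n : ℕ) : (stack A B e n).IsProper := by
  induction n with
  | zero => exact hA
  | succ n ih => exact addStratum_isProper _ _ _ ih

instance isIso_stackBody (n : ℕ) : IsIso (stackBody A B e n) := by
  induction n with
  | zero => exact inferInstanceAs (IsIso (eqToHom e))
  | succ n ih =>
    exact inferInstanceAs (IsIso
      (addStratumBody (stack A B e n) (B.st n) (stackBody A B e n) ≫ (B.glue n).hom))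

theorem bodyMap_stackStep (n : ℕ) :
    bodyMap (stackStep A B e n) ≫ stackBody A B e (n + 1) = stackBody A B e n ≫ B.step n := by
  have h := bodyMap_addStratumBody (stack A B e n) (B.st n) (stackBody A B e n) =≫ (B.glue n).hom
  rwa [Category.assoc, Category.assoc] at h

theorem stackDiagram_map_succ (n : ℕ) :
    (stackDiagram A B e).map (homOfLE (n.le_add_right 1)) = stackStep A B e n :=
  Functor.ofSequence_map_homOfLE_succ (stackStep A B e) n

end Stack

end StrataSeq

/-! ### Colimits of strata -/

namespace Stratum

/-- The functor taking a stratum to its boundary. -/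
def space : Stratum.{u} ⥤ TopCat.{u} where
  obj P := P.X
  map φ := φ.f

/-- The functor taking a stratum to its set of cells. -/
def cells : Stratum.{u} ⥤ Type u where
  obj P := P.S
  map φ := TypeCat.ofHom φ.p

/-- The functor taking a stratum to its body. -/
def bodyFunctor : Stratum.{u} ⥤ TopCat.{u} where
  obj P := P.body
  map φ := bodyMap φ
  map_id := bodyMap_id
  map_comp := bodyMap_comp

theorem sigma_hom_ext {G : ℕ → TopCat.{u}} {W : TopCat.{u}} {m n : ℕ} {a : G m ⟶ W}
    {b : G n ⟶ W} (h : m = n) (hab : a = eqToHom (congrArg G h) ≫ b) :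
    (⟨m, a⟩ : Σ n, (G n ⟶ W)) = ⟨n, b⟩ := by
  subst h
  rw [hab, eqToHom_refl, Category.id_comp]

/-- The stratum on `W` with one cell for every map from a disk to `W`; its cells with their
characteristic maps are the universal way to extend the identity of `W` to a body. -/
def ofSpace (W : TopCat.{u}) : Stratum.{u} where
  X := W
  S := Σ n, (disk.{u} n ⟶ W)
  κ := Sigma.fst
  b s := diskBoundaryInclusion s.1 ≫ s.2

/-- Maps from the body of `P` to `W` are morphisms of strata from `P` to `ofSpace W`. -/
def bodyHomEquiv (P : Stratum.{u}) (W : TopCat.{u}) : (P.body ⟶ W) ≃ (P ⟶ ofSpace W) where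
  toFun g :=
    { f := P.incl ≫ g
      p := fun s => ⟨P.κ s, P.cell s ≫ g⟩
      hκ := fun _ => rfl
      hb := fun s => ((reassoc_of% P.condition s) g).trans (Category.id_comp _).symm }
  invFun φ := P.desc φ.f (fun s => eqToHom (congrArg disk.{u} (φ.hκ s)) ≫ (φ.p s).2) fun s => by
    refine (φ.hb s).trans ((Category.assoc _ _ _).symm.trans ?_)
    exact ((boundary_eqToHom (φ.hκ s)).symm =≫ _).trans (Category.assoc _ _ _)
  left_inv g := P.body_hom_ext (P.incl_desc _ _ _) fun s =>
    (P.cell_desc _ _ _ s).trans (Category.id_comp _)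
  right_inv φ := Stratum.hom_ext (P.incl_desc _ _ _) (funext fun s =>
    sigma_hom_ext (φ.hκ s) (P.cell_desc _ _ _ s))

theorem bodyHomEquiv_naturality (P Q : Stratum.{u}) (W : TopCat.{u}) (φ : P ⟶ Q)
    (g : Q.body ⟶ W) : bodyHomEquiv P W (bodyMap φ ≫ g) = φ ≫ bodyHomEquiv Q W g :=
  Stratum.hom_ext ((reassoc_of% incl_bodyMap φ) g) (funext fun s =>
    sigma_hom_ext (φ.hκ s) ((reassoc_of% cell_bodyMap φ s) g))

instance isLeftAdjoint_bodyFunctor : bodyFunctor.{u}.IsLeftAdjoint :=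
  (Adjunction.adjunctionOfEquivRight bodyHomEquiv bodyHomEquiv_naturality).isLeftAdjoint

section Colimit

variable {J : Type} [SmallCategory J] (F : J ⥤ Stratum.{u}) (c : Cocone (F ⋙ space))

/-- The attaching maps of the cells of the strata of a diagram, as maps to a cocone over the
boundaries. -/
def attachCocone : (F ⋙ cells).CoconeTypes where
  pt := Σ n, (diskBoundary.{u} n ⟶ c.pt)
  ι j s := ⟨(F.obj j).κ s, (F.obj j).b s ≫ c.ι.app j⟩
  ι_naturality f := funext fun s => (sigma_hom_ext ((F.map f).hκ s) (by
    refine .trans ?_ (((F.map f).hb s =≫ c.ι.app _).trans (Category.assoc _ _ _))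
    exact ((Category.assoc _ _ _).trans (congrArg ((F.obj _).b s ≫ ·) (c.w f))).symm)).symm

/-- The stratum on the vertex of a cocone over the boundaries whose cells form the colimit of the
sets of cells of a diagram of strata. -/
def colimitOver : Stratum.{u} where
  X := c.pt
  S := (F ⋙ cells).ColimitType
  κ s := ((F ⋙ cells).descColimitType (attachCocone F c) s).1
  b s := ((F ⋙ cells).descColimitType (attachCocone F c) s).2

/-- The cocone of strata over a cocone of boundaries. -/
def coconeOver : Cocone F where
  pt := colimitOver F c
  ι :=
    { app := fun j =>
        { f := c.ι.app j
          p := (F ⋙ cells).ιColimitType j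
          hκ := fun _ => rfl
          hb := fun _ => (Category.id_comp _).symm }
      naturality := fun _ _ f => Stratum.hom_ext (c.ι.naturality f)
        (funext fun s => (F ⋙ cells).ιColimitType_map f s) }

variable {F c}

/-- The morphism of strata out of the colimit induced by a cocone. -/
def descOver (hc : IsColimit c) (t : Cocone F) : colimitOver F c ⟶ t.pt where
  f := hc.desc (space.mapCocone t)
  p := (F ⋙ cells).descColimitType
    { pt := t.pt.S
      ι := fun j => (t.ι.app j).p
      ι_naturality := fun f => congrArg Hom.p (t.w f) }
  hκ s := by
    obtain ⟨j, s, rfl⟩ := (F ⋙ cells).ιColimitType_jointly_surjective s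
    exact (t.ι.app j).hκ s
  hb s := by
    obtain ⟨j, s, rfl⟩ := (F ⋙ cells).ιColimitType_jointly_surjective s
    refine .trans ((Category.assoc _ _ _).trans ?_) ((t.ι.app j).hb s)
    exact congrArg ((F.obj j).b s ≫ ·) (hc.fac (space.mapCocone t) j)

def isColimitCoconeOver (hc : IsColimit c) : IsColimit (coconeOver F c) where
  desc := descOver hc
  fac t j := Stratum.hom_ext (hc.fac (space.mapCocone t) j) rfl
  uniq t m hm := by
    refine Stratum.hom_ext (hc.uniq (space.mapCocone t) m.f fun j => congrArg Hom.f (hm j))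
      (funext fun s => ?_)
    obtain ⟨j, s, rfl⟩ := (F ⋙ cells).ιColimitType_jointly_surjective s
    exact congrFun (congrArg Hom.p (hm j)) s

end Colimit

end Stratum

namespace StrataSeq

/-- The functor taking a sequence of strata to its `k`-th stratum. -/
def stratum (k : ℕ) : StrataSeq.{u} ⥤ Stratum.{u} where
  obj A := A.st k
  map φ := φ.φ k

/-- The identification of the bodies of the `k`-th strata with the `k + 1`-st spaces. -/
def glueIso (k : ℕ) : stratum.{u} k ⋙ Stratum.bodyFunctor ≅ stratum (k + 1) ⋙ Stratum.space :=
  NatIso.ofComponents (fun A => A.glue k) fun φ => (φ.coherent k).symm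

variable {J : Type} [SmallCategory J] (F : J ⥤ StrataSeq.{u})

/-- A cocone over the `k + 1`-st spaces of a diagram of sequences of strata given by a cocone over
the `k`-th strata: its vertex is the body of the vertex of that cocone. -/
def nextCocone {k : ℕ} (c : Cocone (F ⋙ stratum k)) :
    Cocone ((F ⋙ stratum (k + 1)) ⋙ Stratum.space) :=
  (Cocone.precompose (Functor.isoWhiskerLeft F (glueIso k)).inv).obj
    (Stratum.bodyFunctor.mapCocone c)

/-- The next cocone is a colimit, since taking the body preserves colimits. -/
def isColimitNextCocone {k : ℕ} {c : Cocone (F ⋙ stratum k)} (hc : IsColimit c) :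
    IsColimit (nextCocone F c) :=
  (IsColimit.precomposeInvEquiv (Functor.isoWhiskerLeft F (glueIso k))
    (Stratum.bodyFunctor.mapCocone c)).symm (isColimitOfPreserves Stratum.bodyFunctor hc)

/-- The colimits of the `k`-th spaces of a diagram of sequences of strata, each built from the
previous one. -/
def spaceColimit : ∀ k : ℕ, ColimitCocone ((F ⋙ stratum k) ⋙ Stratum.space)
  | 0 => getColimitCocone _
  | k + 1 => ⟨nextCocone F (Stratum.coconeOver _ (spaceColimit k).cocone),
      isColimitNextCocone F (Stratum.isColimitCoconeOver (spaceColimit k).isColimit)⟩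

/-- The colimit cocone of the `k`-th strata of a diagram of sequences of strata. -/
def stratumCocone (k : ℕ) : Cocone (F ⋙ stratum k) :=
  Stratum.coconeOver _ (spaceColimit F k).cocone

def isColimitStratumCocone (k : ℕ) : IsColimit (stratumCocone F k) :=
  Stratum.isColimitCoconeOver (spaceColimit F k).isColimit

/-- The cocone of sequences of strata formed by the colimits of the `k`-th strata. -/
def colimitCocone : Cocone F where
  pt :=
    { st := fun k => (stratumCocone F k).pt
      connected := fun _ => rfl }
  ι :=
    { app := fun j =>
        { φ := fun k => (stratumCocone F k).ι.app j
          coherent := fun _ => (Iso.hom_inv_id_assoc _ _).trans (Category.comp_id _).symm }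
      naturality := fun _ _ f => StrataSeq.hom_ext fun k => (stratumCocone F k).ι.naturality f }

variable {F}

section Desc

variable {c : Cocone F} (hc : ∀ k, IsColimit ((stratum k).mapCocone c)) (t : Cocone F)

/-- The morphisms of strata induced by a cocone of sequences of strata. -/
def descStratum (k : ℕ) : c.pt.st k ⟶ t.pt.st k := (hc k).desc ((stratum k).mapCocone t)

theorem ι_descStratum (k : ℕ) (j : J) :
    (c.ι.app j).φ k ≫ descStratum hc t k = (t.ι.app j).φ k :=
  (hc k).fac ((stratum k).mapCocone t) j

theorem descStratum_coherent (k : ℕ) :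
    (c.pt.glue k).hom ≫ (descStratum hc t (k + 1)).f =
      Stratum.bodyMap (descStratum hc t k) ≫ (t.pt.glue k).hom := by
  refine (isColimitOfPreserves Stratum.bodyFunctor (hc k)).hom_ext fun j => ?_
  have hc' : ((F.obj j).glue k).hom ≫ ((c.ι.app j).φ (k + 1)).f =
      Stratum.bodyMap ((c.ι.app j).φ k) ≫ (c.pt.glue k).hom := (c.ι.app j).coherent k
  have ht : ((F.obj j).glue k).hom ≫ ((t.ι.app j).φ (k + 1)).f =
      Stratum.bodyMap ((t.ι.app j).φ k) ≫ (t.pt.glue k).hom := (t.ι.app j).coherent k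
  change Stratum.bodyMap ((c.ι.app j).φ k) ≫ _ = Stratum.bodyMap ((c.ι.app j).φ k) ≫ _
  rw [← reassoc_of% hc', ← Stratum.comp_f, ι_descStratum, ← Category.assoc,
    ← Stratum.bodyMap_comp, ι_descStratum, ht]

def isColimitOfStratum : IsColimit c where
  desc t :=
    { φ := descStratum hc t
      coherent := descStratum_coherent hc t }
  fac t j := StrataSeq.hom_ext fun k => ι_descStratum hc t k j
  uniq t m hm := StrataSeq.hom_ext fun k => (hc k).uniq ((stratum k).mapCocone t) (m.φ k)
    fun j => congrArg (fun φ => Hom.φ φ k) (hm j)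

end Desc

variable (F) in
def isColimitColimitCocone : IsColimit (colimitCocone F) :=
  isColimitOfStratum (isColimitStratumCocone F)

theorem colimitCocone_pt_isProper (hF : ∀ j, (F.obj j).IsProper) :
    (colimitCocone F).pt.IsProper := by
  intro n s m h
  obtain ⟨j, s, rfl⟩ := ((F ⋙ stratum n) ⋙ Stratum.cells).ιColimitType_jointly_surjective s
  exact fun hg => hF j n s m h
    (exists_factor_of_map ((colimitCocone F).ι.app j) h.le (((F.obj j).st n).b s) hg)

end StrataSeq

/-! ### Existence of composites -/

theorem isIso_map_of_isIso_map_succ {C : Type v} [Category.{w} C] (F : ℕ ⥤ C)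
    (h : ∀ n : ℕ, IsIso (F.map (homOfLE (n.le_add_right 1)))) {m n : ℕ} (f : m ⟶ n) :
    IsIso (F.map f) := by
  rw [Subsingleton.elim f (homOfLE (leOfHom f))]
  induction n, leOfHom f using Nat.le_induction with
  | base => exact inferInstanceAs (IsIso (F.map (𝟙 m)))
  | succ n hn ih =>
    have := ih (homOfLE hn)
    rw [← homOfLE_comp hn (n.le_add_right 1), F.map_comp]
    infer_instance

namespace StrataSeq

section Colimit

variable {J : Type} [SmallCategory J] {F : J ⥤ StrataSeq.{u}}

/-- The cocone of cell complexes given by a cocone of proper sequences of strata. -/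
def cellCxCocone (hF : ∀ j, (F.obj j).IsProper) (c : Cocone F) (hc : c.pt.IsProper) :
    Cocone (ObjectProperty.lift IsProper F hF) where
  pt := ⟨c.pt, hc⟩
  ι :=
    { app := fun j => ObjectProperty.homMk (c.ι.app j)
      naturality := fun _ _ f => ObjectProperty.hom_ext _ (c.ι.naturality f) }

/-- The underlying map of a colimit of cell complexes is the colimit of the underlying maps, since
`U` is a left adjoint. -/
def isColimitUnderlying (hF : ∀ j, (F.obj j).IsProper) {c : Cocone F} (h : IsColimit c)
    (hc : c.pt.IsProper) : IsColimit (underlying.mapCocone c) :=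
  have := freeProperty.adj.leftAdjoint_preservesColimits
  have hι : IsColimit (cellCxCocone hF c hc) :=
    isColimitOfReflects (ObjectProperty.ι (C := StrataSeq.{u}) IsProper) h
  isColimitOfPreserves CellCx.U hι

end Colimit

section Stack

variable (A B : StrataSeq.{u}) (e : A.body = B.X 0)

/-- The identification of the bodies of the stacks with the spaces of the second sequence. -/
def stackBodyTrans : stackDiagram A B e ⋙ underlying ⋙ Arrow.rightFunc ⟶ B.diagram :=
  NatTrans.ofSequence (stackBody A B e) fun n => by
    change bodyMap ((stackDiagram A B e).map _) ≫ _ = _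
    rw [stackDiagram_map_succ]
    exact (bodyMap_stackStep A B e n).trans (stackBody A B e n ≫=
      (Functor.ofSequence_map_homOfLE_succ (X := B.X) B.step n).symm)

instance isIso_stackBodyTrans : IsIso (stackBodyTrans A B e) :=
  have (n : ℕ) : IsIso ((stackBodyTrans A B e).app n) := isIso_stackBody A B e n
  NatIso.isIso_of_isIso_app _

theorem isIso_stackDiagram_map {m n : ℕ} (f : m ⟶ n) :
    IsIso (((stackDiagram A B e ⋙ underlying) ⋙ Arrow.leftFunc).map f) :=
  isIso_map_of_isIso_map_succ _ (fun n => by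
    change IsIso (((stackDiagram A B e).map (homOfLE _)).φ 0).f
    rw [stackDiagram_map_succ]
    exact inferInstanceAs (IsIso (𝟙 _))) f

variable {A B e}

theorem isIso_boundary_of_isColimit {c : Cocone (stackDiagram A B e)}
    (hc : IsColimit (underlying.mapCocone c)) : IsIso ((c.ι.app 0).φ 0).f := by
  have (i j : ℕ) (f : i ⟶ j) := isIso_stackDiagram_map A B e f
  have h₀ : IsInitial (0 : ℕ) := .ofUniqueHom (fun n => homOfLE n.zero_le) fun _ _ => rfl
  exact inferInstanceAs (IsIso ((colimitOfDiagramInitial h₀ _).coconePointUniqueUpToIso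
    (isColimitOfPreserves Arrow.leftFunc hc)).hom)

/-- The body of a colimit of the stacks is the body of the second complex. -/
def stackColimitBodyIso {c : Cocone (stackDiagram A B e)}
    (hc : IsColimit (underlying.mapCocone c)) : c.pt.body ≅ B.body :=
  (isColimitOfPreserves Arrow.rightFunc hc).coconePointsIsoOfNatIso (colimit.isColimit B.diagram)
    (asIso (stackBodyTrans A B e))

theorem bodyMap_stackColimitBodyIso {c : Cocone (stackDiagram A B e)}
    (hc : IsColimit (underlying.mapCocone c)) (n : ℕ) :
    bodyMap (c.ι.app n) ≫ (stackColimitBodyIso hc).hom = stackBody A B e n ≫ B.toBody n :=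
  IsColimit.comp_coconePointsIsoOfNatIso_hom (isColimitOfPreserves Arrow.rightFunc hc)
    (colimit.isColimit B.diagram) (asIso (stackBodyTrans A B e)) n

end Stack

end StrataSeq

namespace CellCx

open StrataSeq

/-- The composite given by a proper colimit of the stacks. -/
def Composite.ofIsColimit {A B : CellCx.{u}} {e : A.obj.body = B.obj.X 0}
    {c : Cocone (stackDiagram A.obj B.obj e)} (hc : IsColimit c) (hp : c.pt.IsProper) :
    Composite A B e :=
  have hu := isColimitUnderlying (stack_isProper A.obj B.obj e A.property) hc hp
  have := isIso_boundary_of_isColimit hu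
  { cocone := c
    isColimit := hc
    proper := hp
    iso := Arrow.isoMk (asIso ((c.ι.app 0).φ 0).f).symm (stackColimitBodyIso hu) (by
      refine (IsIso.inv_comp_eq ((c.ι.app 0).φ 0).f).2 (.trans ?_ (Category.assoc _ _ _))
      refine .trans ?_ (toBody_bodyMap (c.ι.app 0) 0 =≫ (stackColimitBodyIso hu).hom)
      rw [Category.assoc, bodyMap_stackColimitBodyIso]
      rfl)
    iso_left := IsIso.hom_inv_id ((c.ι.app 0).φ 0).f
    iso_right := bodyMap_stackColimitBodyIso hu }

theorem nonempty_composite (A B : CellCx.{u}) (e : A.obj.body = B.obj.X 0) :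
    Nonempty (Composite A B e) :=
  ⟨.ofIsColimit (isColimitColimitCocone _)
    (colimitCocone_pt_isProper (stack_isProper A.obj B.obj e A.property))⟩

end CellCx

/-! ### Algebraic weak factorisation systems from cellular maps -/

namespace FunctorialFactorisation

variable {C : Type v} [Category.{w} C] (F : FunctorialFactorisation C)

/-- The first factor of an arrow. -/
abbrev fst (f : Arrow C) : f.left ⟶ F.Z.obj f := F.i.app f

/-- The second factor of an arrow. -/
abbrev snd (f : Arrow C) : F.Z.obj f ⟶ f.right := F.p.app f

theorem fst_map {f g : Arrow C} (α : f ⟶ g) : F.fst f ≫ F.Z.map α = α.left ≫ F.fst g :=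
  (F.i.naturality α).symm

theorem map_snd {f g : Arrow C} (α : f ⟶ g) : F.Z.map α ≫ F.snd g = F.snd f ≫ α.right :=
  F.p.naturality α

theorem fst_snd (f : Arrow C) : F.fst f ≫ F.snd f = f.hom := F.fac_app

/-- `F.L.map α` with reducible components. -/
abbrev fstSq {f g : Arrow C} (α : f ⟶ g) : Arrow.mk (F.fst f) ⟶ Arrow.mk (F.fst g) :=
  Arrow.homMk (u := α.left) (v := F.Z.map α) (F.fst_map α).symm

/-- `F.R.map α` with reducible components. -/
abbrev sndSq {f g : Arrow C} (α : f ⟶ g) : Arrow.mk (F.snd f) ⟶ Arrow.mk (F.snd g) :=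
  Arrow.homMk (u := F.Z.map α) (v := α.right) (F.map_snd α)

/-- `F.ε.app f` with reducible components. -/
abbrev counitSq (f : Arrow C) : Arrow.mk (F.fst f) ⟶ f :=
  Arrow.homMk (u := 𝟙 f.left) (v := F.snd f) ((Category.id_comp _).trans (F.fst_snd f).symm)

/-- `F.η.app f` with reducible components. -/
abbrev unitSq (f : Arrow C) : f ⟶ Arrow.mk (F.snd f) :=
  Arrow.homMk (u := F.fst f) (v := 𝟙 f.right) ((F.fst_snd f).trans (Category.comp_id _).symm)

/-- Data that turn a functorial factorisation into an algebraic weak factorisation system: a class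
of maps between the central objects which are determined by their restriction along the first and
their composite with the second factors, with structure maps `δ` and `μ` in this class. All laws
then follow from this uniqueness. -/
structure CellularData where
  Cellular : ∀ {f g : Arrow C}, (F.Z.obj f ⟶ F.Z.obj g) → Prop
  id : ∀ f : Arrow C, Cellular (𝟙 (F.Z.obj f))
  comp : ∀ {f g h : Arrow C} {a : F.Z.obj f ⟶ F.Z.obj g} {b : F.Z.obj g ⟶ F.Z.obj h},
    Cellular a → Cellular b → Cellular (a ≫ b)
  map : ∀ {f g : Arrow C} (α : f ⟶ g), Cellular (F.Z.map α)
  ext : ∀ {f g : Arrow C} {a b : F.Z.obj f ⟶ F.Z.obj g}, Cellular a → Cellular b →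
    F.fst f ≫ a = F.fst f ≫ b → a ≫ F.snd g = b ≫ F.snd g → a = b
  δ : ∀ f : Arrow C, F.Z.obj f ⟶ F.Z.obj (Arrow.mk (F.fst f))
  cellular_δ : ∀ f, Cellular (δ f)
  fst_δ : ∀ f, F.fst f ≫ δ f = F.fst (Arrow.mk (F.fst f))
  δ_snd : ∀ f, δ f ≫ F.snd (Arrow.mk (F.fst f)) = 𝟙 (F.Z.obj f)
  μ : ∀ f : Arrow C, F.Z.obj (Arrow.mk (F.snd f)) ⟶ F.Z.obj f
  cellular_μ : ∀ f, Cellular (μ f)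
  fst_μ : ∀ f, F.fst (Arrow.mk (F.snd f)) ≫ μ f = 𝟙 (F.Z.obj f)
  μ_snd : ∀ f, μ f ≫ F.snd f = F.snd (Arrow.mk (F.snd f))

namespace CellularData

variable {F} (D : CellularData F)

/-- The comultiplication as a square. -/
abbrev δSq (f : Arrow C) : Arrow.mk (F.fst f) ⟶ Arrow.mk (F.fst (Arrow.mk (F.fst f))) :=
  Arrow.homMk (u := 𝟙 f.left) (v := D.δ f) ((Category.id_comp _).trans (D.fst_δ f).symm)

/-- The multiplication as a square. -/
abbrev μSq (f : Arrow C) : Arrow.mk (F.snd (Arrow.mk (F.snd f))) ⟶ Arrow.mk (F.snd f) :=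
  Arrow.homMk (u := D.μ f) (v := 𝟙 f.right) ((D.μ_snd f).trans (Category.comp_id _).symm)

/-- The distributive law as a square. -/
abbrev ΔSq (f : Arrow C) :
    Arrow.mk (F.fst (Arrow.mk (F.snd f))) ⟶ Arrow.mk (F.snd (Arrow.mk (F.fst f))) :=
  Arrow.homMk (u := D.δ f) (v := D.μ f) ((D.δ_snd f).trans (D.fst_μ f).symm)

theorem comp_fst_μ (f : Arrow C) {X : C} (a : X ⟶ F.Z.obj f) :
    a ≫ F.fst (Arrow.mk (F.snd f)) ≫ D.μ f = a :=
  (a ≫= D.fst_μ f).trans (Category.comp_id a)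

theorem comp_δ_snd (f : Arrow C) {X : C} (a : X ⟶ F.Z.obj f) :
    a ≫ D.δ f ≫ F.snd (Arrow.mk (F.fst f)) = a :=
  (a ≫= D.δ_snd f).trans (Category.comp_id a)

theorem δ_naturality {f g : Arrow C} (α : f ⟶ g) :
    F.Z.map α ≫ D.δ g = D.δ f ≫ F.Z.map (F.fstSq α) := by
  refine D.ext (D.comp (D.map _) (D.cellular_δ _)) (D.comp (D.cellular_δ _) (D.map _)) ?_ ?_
  · rw [reassoc_of% F.fst_map _, D.fst_δ, reassoc_of% D.fst_δ _]
    exact (F.fst_map (F.fstSq α)).symm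
  · rw [Category.assoc, D.comp_δ_snd, Category.assoc, map_snd]
    exact ((reassoc_of% D.δ_snd f) (F.Z.map α)).symm

theorem coassoc (f : Arrow C) :
    D.δ f ≫ F.Z.map (D.δSq f) = D.δ f ≫ D.δ (Arrow.mk (F.fst f)) := by
  refine D.ext (D.comp (D.cellular_δ _) (D.map _)) (D.comp (D.cellular_δ _) (D.cellular_δ _))
    ?_ ?_
  · rw [reassoc_of% D.fst_δ _, reassoc_of% D.fst_δ _, fst_map]
    refine (Category.id_comp _).trans ?_
    exact (D.fst_δ (Arrow.mk (F.fst f))).symm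
  · rw [Category.assoc, Category.assoc, map_snd, D.comp_δ_snd]
    exact (reassoc_of% D.δ_snd f) (D.δ f)

theorem δ_map_counit (f : Arrow C) : D.δ f ≫ F.Z.map (F.counitSq f) = 𝟙 _ := by
  refine D.ext (D.comp (D.cellular_δ _) (D.map _)) (D.id _) ?_ ?_
  · rw [reassoc_of% D.fst_δ _, Category.comp_id, fst_map]
    exact Category.id_comp _
  · rw [Category.assoc, Category.id_comp, map_snd]
    exact (reassoc_of% D.δ_snd f) (F.snd f)

theorem μ_naturality {f g : Arrow C} (α : f ⟶ g) :
    F.Z.map (F.sndSq α) ≫ D.μ g = D.μ f ≫ F.Z.map α := by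
  refine D.ext (D.comp (D.map _) (D.cellular_μ _)) (D.comp (D.cellular_μ _) (D.map _)) ?_ ?_
  · rw [reassoc_of% D.fst_μ _, reassoc_of% F.fst_map _]
    exact (D.comp_fst_μ g (F.Z.map α)).trans (Category.id_comp _).symm
  · rw [Category.assoc, Category.assoc, D.μ_snd, map_snd, map_snd]
    exact ((reassoc_of% D.μ_snd f) α.right).symm

theorem assoc (f : Arrow C) :
    F.Z.map (D.μSq f) ≫ D.μ f = D.μ (Arrow.mk (F.snd f)) ≫ D.μ f := by
  refine D.ext (D.comp (D.map _) (D.cellular_μ _)) (D.comp (D.cellular_μ _) (D.cellular_μ _))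
    ?_ ?_
  · rw [reassoc_of% D.fst_μ _, reassoc_of% F.fst_map _]
    exact (D.comp_fst_μ f (D.μ f)).trans (Category.id_comp _).symm
  · rw [Category.assoc, Category.assoc, D.μ_snd, D.μ_snd, map_snd]
    exact Category.comp_id _

theorem map_unit_μ (f : Arrow C) : F.Z.map (F.unitSq f) ≫ D.μ f = 𝟙 _ := by
  refine D.ext (D.comp (D.map _) (D.cellular_μ _)) (D.id _) ?_ ?_
  · rw [reassoc_of% F.fst_map _, Category.comp_id]
    exact D.comp_fst_μ f (F.fst f)
  · rw [Category.assoc, Category.id_comp, D.μ_snd, map_snd]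
    exact Category.comp_id _

theorem μ_δ (f : Arrow C) : D.μ f ≫ D.δ f =
    D.δ (Arrow.mk (F.snd f)) ≫ F.Z.map (D.ΔSq f) ≫ D.μ (Arrow.mk (F.fst f)) := by
  refine D.ext (D.comp (D.cellular_μ _) (D.cellular_δ _))
    (D.comp (D.cellular_δ _) (D.comp (D.map _) (D.cellular_μ _))) ?_ ?_
  · rw [reassoc_of% D.fst_μ _, reassoc_of% D.fst_δ _, reassoc_of% F.fst_map _]
    exact (Category.id_comp _).trans (D.comp_fst_μ (Arrow.mk (F.fst f)) (D.δ f)).symm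
  · rw [Category.assoc, D.comp_δ_snd, Category.assoc, Category.assoc, D.μ_snd, map_snd]
    exact ((reassoc_of% D.δ_snd (Arrow.mk (F.snd f))) (D.μ f)).symm

/-- The algebraic weak factorisation system given by cellular data. -/
def algebraicWFS : AlgebraicWFS F where
  δ :=
    { app := D.δSq
      naturality := fun _ _ α => Arrow.hom_ext _ _
        ((Category.comp_id _).trans (Category.id_comp _).symm) (D.δ_naturality α) }
  coassoc f := Arrow.hom_ext _ _ rfl (D.coassoc f)
  left_counit f := Arrow.hom_ext _ _ (Category.id_comp _) (D.δ_snd f)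
  right_counit f := Arrow.hom_ext _ _ (Category.id_comp _) (D.δ_map_counit f)
  μ :=
    { app := D.μSq
      naturality := fun _ _ α => Arrow.hom_ext _ _ (D.μ_naturality α)
        ((Category.comp_id _).trans (Category.id_comp _).symm) }
  assoc f := Arrow.hom_ext _ _ (D.assoc f) rfl
  left_unit f := Arrow.hom_ext _ _ (D.fst_μ f) (Category.id_comp _)
  right_unit f := Arrow.hom_ext _ _ (D.map_unit_μ f) (Category.id_comp _)
  Δ :=
    { app := D.ΔSq
      naturality := fun _ _ α => Arrow.hom_ext _ _ (D.δ_naturality α) (D.μ_naturality α) }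
  Δ_left _ := rfl
  Δ_right _ := rfl
  Δ_unit f := Arrow.hom_ext _ _ (D.fst_δ f) (D.map_unit_μ f)
  Δ_counit f := Arrow.hom_ext _ _ (D.δ_map_counit f) (D.μ_snd f)
  Δ_mul f := Arrow.hom_ext _ _ (D.μ_δ f)
    ((D.assoc f).trans (D.μ (Arrow.mk (F.snd f)) ≫= (Category.comp_id _).symm))
  Δ_comul f := Arrow.hom_ext _ _
    ((D.coassoc f).trans (Category.id_comp _).symm) (D.μ_δ f)

end CellularData

end FunctorialFactorisation

/-! ### Cellular maps -/

namespace StrataSeq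

variable {A B C : StrataSeq.{u}}

/-- The characteristic maps of cells of dimension `n`. Cells of the same dimension can be compared
without reference to the strata that contain them. -/
inductive IsChar (A : StrataSeq.{u}) : ∀ n : ℕ, (disk.{u} n ⟶ A.body) → Prop
  | char (k : ℕ) (s : (A.st k).S) : IsChar A ((A.st k).κ s) (A.char k s)

theorem IsChar.eqToHom_comp {m n : ℕ} (h : m = n) {c : disk.{u} n ⟶ A.body}
    (hc : A.IsChar n c) : A.IsChar m (eqToHom (congrArg disk.{u} h) ≫ c) := by
  subst h
  simpa only [eqToHom_refl, Category.id_comp] using hc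

theorem IsChar.exists_eq {n : ℕ} {c : disk.{u} n ⟶ A.body} (hc : A.IsChar n c) :
    ∃ (k : ℕ) (s : (A.st k).S) (h : n = (A.st k).κ s),
      c = eqToHom (congrArg disk.{u} h) ≫ A.char k s := by
  obtain ⟨k, s⟩ := hc
  exact ⟨k, s, rfl, (Category.id_comp _).symm⟩

theorem NewCell.isChar_char {T : Stratum.{u}} {q : A.body ⟶ T.X} {k : ℕ} (t : NewCell A T q k) :
    (addStratum A T q).IsChar (T.κ t.1) t.char :=
  IsChar.char (A := addStratum A T q) k (Sum.inr t)

/-- A map between bodies is cellular if it preserves the characteristic maps of cells. -/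
def IsCellular (v : A.body ⟶ B.body) : Prop :=
  ∀ (n : ℕ) (c : disk.{u} n ⟶ A.body), A.IsChar n c → B.IsChar n (c ≫ v)

theorem isCellular_bodyMap (φ : A ⟶ B) : IsCellular (bodyMap φ) := by
  rintro _ _ ⟨k, s⟩
  rw [char_bodyMap]
  exact (IsChar.char _ _).eqToHom_comp ((φ.φ k).hκ s)

theorem IsCellular.comp {a : A.body ⟶ B.body} {b : B.body ⟶ C.body} (ha : IsCellular a)
    (hb : IsCellular b) : IsCellular (a ≫ b) := by
  intro n c hc
  rw [← Category.assoc]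
  exact hb n _ (ha n c hc)

theorem isCellular_id (A : StrataSeq.{u}) : IsCellular (𝟙 A.body) := by
  intro n c hc
  rwa [Category.comp_id]

theorem boundary_eqToHom_char {d k : ℕ} (s : (A.st k).S) (h : d = (A.st k).κ s) :
    diskBoundaryInclusion d ≫ eqToHom (congrArg disk.{u} h) ≫ A.char k s =
      (eqToHom (congrArg diskBoundary.{u} h) ≫ (A.st k).b s) ≫ A.toBody k := by
  rw [reassoc_of% Stratum.boundary_eqToHom h, boundary_char, Category.assoc]

theorem IsProper.le_of_boundary_eq (hA : A.IsProper) {d k l : ℕ} {s : (A.st k).S}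
    {t : (A.st l).S} (hs : d = (A.st k).κ s) (ht : d = (A.st l).κ t)
    (h : (eqToHom (congrArg diskBoundary.{u} hs) ≫ (A.st k).b s) ≫ A.toBody k =
      (eqToHom (congrArg diskBoundary.{u} ht) ≫ (A.st l).b t) ≫ A.toBody l) : l ≤ k := by
  by_contra! hkl
  subst ht
  refine hA l t k hkl ⟨eqToHom (congrArg diskBoundary.{u} hs) ≫ (A.st k).b s, ?_⟩
  rw [← cancel_mono (A.toBody l), Category.assoc, trans_toBody, h, eqToHom_refl,
    Category.id_comp]

end StrataSeq

theorem char_freeE {f : Arrow TopCat.{u}} {n : ℕ} (s : ((freeSeq f).st n).S) :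
    (freeSeq f).char n s ≫ freeE f = (freeStage f n).stratum.cell s ≫ (freeStage f n).bodyE := by
  rw [StrataSeq.char, Category.assoc, Category.assoc, glue_toBody_freeE]
  rfl

theorem freeSeq_isChar_ext {f : Arrow TopCat.{u}} {n : ℕ} {c c' : disk.{u} n ⟶ (freeSeq f).body}
    (hc : (freeSeq f).IsChar n c) (hc' : (freeSeq f).IsChar n c')
    (hb : diskBoundaryInclusion n ≫ c = diskBoundaryInclusion n ≫ c')
    (hE : c ≫ freeE f = c' ≫ freeE f) : c = c' := by
  obtain ⟨k, s, hs, rfl⟩ := hc.exists_eq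
  obtain ⟨l, t, ht, rfl⟩ := hc'.exists_eq
  rw [StrataSeq.boundary_eqToHom_char s hs, StrataSeq.boundary_eqToHom_char t ht] at hb
  obtain rfl : k = l := le_antisymm
    ((freeSeq_isProper f).le_of_boundary_eq ht hs hb.symm)
    ((freeSeq_isProper f).le_of_boundary_eq hs ht hb)
  rw [cancel_mono] at hb
  rw [Category.assoc, Category.assoc, char_freeE, char_freeE] at hE
  obtain rfl := (freeStage f k).cell_ext hs ht hb hE
  rfl

theorem freeSeq_isCellular_ext {C : StrataSeq.{u}} {f : Arrow TopCat.{u}}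
    {a b : C.body ⟶ (freeSeq f).body} (ha : StrataSeq.IsCellular a) (hb : StrataSeq.IsCellular b)
    (h₀ : C.toBody 0 ≫ a = C.toBody 0 ≫ b) (hE : a ≫ freeE f = b ≫ freeE f) : a = b := by
  refine C.body_hom_ext_of_boundary h₀ fun n s hs => ?_
  refine freeSeq_isChar_ext (ha _ _ (.char n s)) (hb _ _ (.char n s)) hs ?_
  rw [Category.assoc, Category.assoc, hE]

namespace CellCx.Composite

variable {A B : CellCx.{u}} {e : A.obj.body = B.obj.X 0} (c : CellCx.Composite A B e)

/-- The identification of the body of a composite with the body of the second complex. -/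
def bodyIso : c.cocone.pt.body ≅ B.obj.body where
  hom := c.iso.hom.right
  inv := c.iso.inv.right
  hom_inv_id := congrArg Arrow.Hom.right c.iso.hom_inv_id
  inv_hom_id := congrArg Arrow.Hom.right c.iso.inv_hom_id

/-- The canonical morphism from a stack to the composite. -/
def ofStack (n : ℕ) : StrataSeq.stack A.obj B.obj e n ⟶ c.cocone.pt := c.cocone.ι.app n

theorem bodyMap_ofStack (n : ℕ) : StrataSeq.bodyMap (c.ofStack n) ≫ c.bodyIso.hom =
    StrataSeq.stackBody A.obj B.obj e n ≫ B.obj.toBody n :=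
  c.iso_right n

/-- The new cell of the `(k + 1)`-st stack that corresponds to a cell of `B`. -/
def stackChar (k : ℕ) (t : (B.obj.st k).S) :
    disk.{u} ((B.obj.st k).κ t) ⟶ (StrataSeq.stack A.obj B.obj e (k + 1)).body :=
  (StrataSeq.newCell (StrataSeq.stackBody A.obj B.obj e k) t).char

theorem stackChar_bodyMap_ofStack (k : ℕ) (t : (B.obj.st k).S) :
    stackChar k t ≫ StrataSeq.bodyMap (c.ofStack (k + 1)) = B.obj.char k t ≫ c.bodyIso.inv := by
  have h : stackChar k t ≫ StrataSeq.stackBody A.obj B.obj e (k + 1) =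
      (B.obj.st k).cell t ≫ (B.obj.glue k).hom :=
    (Category.assoc _ _ _).symm.trans
      (StrataSeq.NewCell.char_addStratumBody _ =≫ (B.obj.glue k).hom)
  rw [Iso.eq_comp_inv, Category.assoc, bodyMap_ofStack, reassoc_of% h, StrataSeq.char]

theorem isCellular_bodyIso_inv : StrataSeq.IsCellular c.bodyIso.inv := by
  rintro _ _ ⟨k, t⟩
  rw [← stackChar_bodyMap_ofStack]
  exact StrataSeq.isCellular_bodyMap (c.ofStack (k + 1)) _ _
    (StrataSeq.newCell (StrataSeq.stackBody A.obj B.obj e k) t).isChar_char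

end CellCx.Composite

namespace FreeComposite

variable {f : Arrow TopCat.{u}} (h : FreeProperty.{u}) (c : FreeComposite f)

theorem U_map_equiv : CellCx.U.map (h.equiv c.cx f c.toArrow) ≫ freeCounit f = c.toArrow :=
  (h.equiv c.cx f).symm_apply_apply c.toArrow

/-- The morphism `K E f * K f ⟶ K f` that corresponds to `(1, E E f)`. -/
def mulHom : c.cocone.pt ⟶ freeSeq f := (h.equiv c.cx f c.toArrow).hom

theorem mul_eq : c.mul h = c.bodyIso.inv ≫ StrataSeq.bodyMap (c.mulHom h) := rfl

theorem mulHom_f : ((c.mulHom h).φ 0).f = c.iso.hom.left :=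
  (Category.comp_id _).symm.trans
    ((congrArg Arrow.Hom.left (c.U_map_equiv h)).trans (Category.comp_id _))

theorem bodyMap_mulHom : StrataSeq.bodyMap (c.mulHom h) ≫ freeE f =
    c.bodyIso.hom ≫ freeE (Arrow.mk (freeE f)) :=
  congrArg Arrow.Hom.right (c.U_map_equiv h)

theorem isCellular_mul : StrataSeq.IsCellular (c.mul h) :=
  (CellCx.Composite.isCellular_bodyIso_inv c).comp (StrataSeq.isCellular_bodyMap (c.mulHom h))

theorem mul_freeE : c.mul h ≫ freeE f = freeE (Arrow.mk (freeE f)) := by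
  rw [mul_eq]
  exact (Category.assoc _ _ _).trans
    ((c.bodyIso.inv ≫= c.bodyMap_mulHom h).trans (Iso.inv_hom_id_assoc c.bodyIso _))

/-- The canonical morphism `K f ⟶ K E f * K f`. -/
def inlHom : freeSeq f ⟶ c.cocone.pt := c.ofStack 0

theorem bodyMap_inlHom : StrataSeq.bodyMap c.inlHom ≫ c.bodyIso.hom =
    (freeSeq (Arrow.mk (freeE f))).toBody 0 :=
  (c.bodyMap_ofStack 0).trans (Category.id_comp _)

theorem inlHom_mulHom : c.inlHom ≫ c.mulHom h = 𝟙 (freeSeq f) := by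
  refine freeSeq_hom_ext ?_ ?_
  · rw [StrataSeq.comp_φ, Stratum.comp_f, mulHom_f]
    exact c.iso_left
  · rw [StrataSeq.bodyMap_comp, Category.assoc, bodyMap_mulHom, StrataSeq.bodyMap_id,
      Category.id_comp]
    exact (Category.assoc _ _ _).symm.trans
      ((c.bodyMap_inlHom =≫ freeE (Arrow.mk (freeE f))).trans
        (toBody_freeE (Arrow.mk (freeE f))))

theorem toBody_mul :
    (freeSeq (Arrow.mk (freeE f))).toBody 0 ≫ c.mul h = 𝟙 (freeSeq f).body := by
  rw [← StrataSeq.bodyMap_id, ← c.inlHom_mulHom h, StrataSeq.bodyMap_comp, ← bodyMap_inlHom c,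
    mul_eq]
  exact (Category.assoc _ _ _).trans
    (StrataSeq.bodyMap c.inlHom ≫= Iso.hom_inv_id_assoc c.bodyIso _)

theorem mul_unique (c' : FreeComposite f) : c.mul h = c'.mul h :=
  freeSeq_isCellular_ext (c.isCellular_mul h) (c'.isCellular_mul h)
    ((c.toBody_mul h).trans (c'.toBody_mul h).symm)
    ((c.mul_freeE h).trans (c'.mul_freeE h).symm)

end FreeComposite

/-! ### The algebraic weak factorisation system of free cell complexes -/

theorem comonad_ext_of_app {C : Type v} [Category.{w} C] {G H : Comonad C}
    (h : G.toFunctor = H.toFunctor)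
    (hε : ∀ X, G.ε.app X = eqToHom (Functor.congr_obj h X) ≫ H.ε.app X)
    (hδ : ∀ X, G.δ.app X ≫ eqToHom (Functor.congr_obj (congrArg (fun K => K ⋙ K) h) X) =
      eqToHom (Functor.congr_obj h X) ≫ H.δ.app X) : G = H := by
  obtain ⟨G, ε, δ, _, _, _⟩ := G
  obtain ⟨H, ε', δ', _, _, _⟩ := H
  dsimp only at h
  subst h
  obtain rfl : ε = ε' := by
    ext X
    simpa using hε X
  obtain rfl : δ = δ' := by
    ext X
    simpa using hδ X
  rfl

namespace FreeProperty

variable (h : FreeProperty.{u})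

/-- The morphism `K f ⟶ K U K f` that corresponds to the identity. -/
def comulHom (f : Arrow TopCat.{u}) : freeCx f ⟶ freeCx (CellCx.U.obj (freeCx f)) :=
  h.equiv (freeCx f) (CellCx.U.obj (freeCx f)) (𝟙 _)

theorem U_map_comulHom (f : Arrow TopCat.{u}) :
    CellCx.U.map (h.comulHom f) ≫ freeCounit _ = 𝟙 (CellCx.U.obj (freeCx f)) :=
  (h.equiv (freeCx f) (CellCx.U.obj (freeCx f))).symm_apply_apply _

theorem U_map_comulHom_left (f : Arrow TopCat.{u}) :
    (CellCx.U.map (h.comulHom f)).left = 𝟙 f.left :=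
  (Category.comp_id _).symm.trans (congrArg Arrow.Hom.left (h.U_map_comulHom f))

theorem U_map_K_map_left {f g : Arrow TopCat.{u}} (α : f ⟶ g) :
    (CellCx.U.map (h.K.map α)).left = α.left :=
  (Category.comp_id _).symm.trans
    ((congrArg Arrow.Hom.left (h.U_map_K_map α)).trans (Category.id_comp _))

/-- The multiplication of the monad `E`, formed with a chosen composite of `K f` and `K E f`. -/
def mul (f : Arrow TopCat.{u}) : (freeSeq (Arrow.mk (freeE f))).body ⟶ (freeSeq f).body :=
  FreeComposite.mul h
    (CellCx.nonempty_composite (freeCx f) (freeCx (Arrow.mk (freeE f))) rfl).some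

/-- The cellular maps between the bodies of free cell complexes, with the comultiplication and
the multiplication of the algebraic weak factorisation system. -/
def cellularData : (cellFactorisation h).CellularData where
  Cellular {f g} v := StrataSeq.IsCellular (A := freeSeq f) (B := freeSeq g) v
  id f := StrataSeq.isCellular_id (freeSeq f)
  comp ha hb := ha.comp hb
  map α := StrataSeq.isCellular_bodyMap (h.K.map α).hom
  ext := freeSeq_isCellular_ext
  δ f := StrataSeq.bodyMap (h.comulHom f).hom
  cellular_δ f := StrataSeq.isCellular_bodyMap (h.comulHom f).hom
  fst_δ f := by
    have hw := Arrow.w (CellCx.U.map (h.comulHom f))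
    rw [h.U_map_comulHom_left] at hw
    exact hw.symm.trans (Category.id_comp _)
  δ_snd f := congrArg Arrow.Hom.right (h.U_map_comulHom f)
  μ := h.mul
  cellular_μ _ := FreeComposite.isCellular_mul h _
  fst_μ _ := FreeComposite.toBody_mul h _
  μ_snd _ := FreeComposite.mul_freeE h _

theorem L_eq : (cellFactorisation h).L = h.comonad.toFunctor :=
  Functor.hext (fun _ => rfl) fun _ _ α =>
    heq_of_eq (Arrow.hom_ext _ _ (h.U_map_K_map_left α).symm rfl)

theorem comonad_ε_app (f : Arrow TopCat.{u}) : h.comonad.ε.app f = freeCounit f := by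
  refine .trans (?_ : _ = CellCx.U.map (𝟙 (freeCx f)) ≫ freeCounit f) ?_
  · rfl
  · rw [CategoryTheory.Functor.map_id, Category.id_comp]

theorem comonad_eq : h.cellularData.algebraicWFS.comonad = h.comonad := by
  refine comonad_ext_of_app h.L_eq (fun f => ?_) fun f => ?_
  · exact (h.comonad_ε_app f).symm.trans (Category.id_comp _).symm
  · refine (Category.comp_id _).trans (.trans ?_ (Category.id_comp _).symm)
    exact Arrow.hom_ext _ _ (h.U_map_comulHom_left f).symm rfl

end FreeProperty

end

theorem proposition4p6 :
    ∃ h : FreeProperty.{u},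
      (∀ (A B : CellCx.{u}) (e : A.obj.body = B.obj.X 0), Nonempty (CellCx.Composite A B e)) ∧
      ∃ W : AlgebraicWFS (cellFactorisation h),
        W.comonad = h.comonad ∧
        ∀ (f : Arrow TopCat.{u}) (c : FreeComposite f), (W.monad.μ.app f).left = c.mul h :=
  ⟨freeProperty, CellCx.nonempty_composite, freeProperty.cellularData.algebraicWFS,
    freeProperty.comonad_eq, fun f c => FreeComposite.mul_unique (f := f) freeProperty _ c⟩
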